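/- Graphs are directed multigraphs without self-loops; the degree of a vertex is its in-degree plus its out-degree, counted with multiplicity. For a graph $G=(V,E)$ with $|E|\ge 1$ let $$\mathsf{maxval}(G)=\max_{x:V\to\{0,1\}}\frac{1}{|E|}\sum_{(u,v)\in E}x(u)\,(1-x(v))$$ (the sum counted with multiplicity) be its Max-DICUT value. A (randomized, one-pass) streaming algorithm is an algorithm that knows the number $n$ of vertices, reads the edges one by one, and after each edge updates its memory, a bit string, by a computable function of $n$, the current memory, the edge and fresh uniform random bits; at the end it computes its output from the memory. Its space is the number of memory bits (including any random bits that are kept for later use). **Theorem.** For every $D\in\mathbb N$ and every $\epsilon>0$ there are a one-pass streaming algorithm and constants $c\in(0,1)$ and $C$ such that the following holds for every $n\ge 1$, every graph $G=(V,E)$ with $n$ vertices and maximum degree at most $D$, and every (adversarially chosen) ordering of $E$. The algorithm, run on the edges of $G$ in this order, always uses at most $C\,n^{1-c}$ bits of space. If moreover $E\neq\emptyset$, then with probability at least $99\%$ over its random bits it outputs a number $v$ with $$\Bigl(\tfrac12-\epsilon\Bigr)\,\mathsf{maxval}(G)\le v\le \mathsf{maxval}(G).$$ -/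

import Mathlib

open scoped ENNReal

/-- A graph: a directed multigraph on the finite vertex set `V`, given by its multiset of edges,
an edge being an ordered pair of distinct vertices. -/
structure DiMultigraph (V : Type*) where
  edges : Multiset (V × V)
  loopless : ∀ e ∈ edges, e.1 ≠ e.2

namespace DiMultigraph

variable {V : Type*}

/-- The total degree of `v` (in-degree plus out-degree, with multiplicity). -/
def degree [Fintype V] [DecidableEq V] (G : DiMultigraph V) (v : V) : ℕ :=
  ∑ u : V, (G.edges.count (u, v) + G.edges.count (v, u))

/-- The maximum degree of `G` is at most `D`. -/
def IsBounded [Fintype V] [DecidableEq V] (G : DiMultigraph V) (D : ℕ) : Prop :=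
  ∀ v : V, G.degree v ≤ D

/-- The fraction of the edges `(u, v)`, with multiplicity, for which `x u = 1` and `x v = 0`. -/
noncomputable def val (G : DiMultigraph V) (x : V → Bool) : ℝ :=
  ((G.edges.countP fun e => x e.1 = true ∧ x e.2 = false : ℕ) : ℝ) / (G.edges.card : ℝ)

/-- The Max-DICUT value: the maximum of `G.val x` over all Boolean assignments `x`. -/
noncomputable def maxVal [Fintype V] [DecidableEq V] (G : DiMultigraph V) : ℝ :=
  (Finset.univ : Finset (V → Bool)).sup' Finset.univ_nonempty G.val

/-- The list `σ` is an ordering of the edge multiset of `G`: an edge stream that presents `G`. -/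
def IsOrdering (G : DiMultigraph V) (σ : List (V × V)) : Prop :=
  (σ : Multiset (V × V)) = G.edges

end DiMultigraph

/-- A randomized one-pass streaming algorithm on edge streams. It is one algorithm for all `n`: the
number `n` of vertices is a parameter that it knows, and all its parts are computable. Its memory
is a bit string. Each call of `init`, `update`, `output` receives `coins n` fresh independent
uniform random bits; random bits that are to be used again later have to be kept in memory.
The output pair `(a, b)` stands for the rational number `a / (b + 1)`. -/
structure StreamingAlgorithm where
  /-- the number of random bits supplied to each call -/
  coins : ℕ → ℕ
  /-- vertex number, random bits ↦ initial memory -/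
  init : ℕ → List Bool → List Bool
  /-- vertex number, current memory, next edge, random bits ↦ new memory -/
  update : ℕ → List Bool → ℕ × ℕ → List Bool → List Bool
  /-- vertex number, final memory, random bits ↦ answer -/
  output : ℕ → List Bool → List Bool → ℕ × ℕ
  computable_coins : Computable coins
  computable_init : Computable fun p : ℕ × List Bool => init p.1 p.2
  computable_update : Computable fun p : (ℕ × List Bool) × ((ℕ × ℕ) × List Bool) =>
    update p.1.1 p.1.2 p.2.1 p.2.2
  computable_output : Computable fun p : ℕ × (List Bool × List Bool) =>
    output p.1 p.2.1 p.2.2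

namespace StreamingAlgorithm

/-- A string of `r` independent uniform random bits. -/
noncomputable def randomBits (r : ℕ) : PMF (List Bool) :=
  (PMF.uniformOfFintype (Fin r → Bool)).map List.ofFn

/-- The distribution of the memory after the stream `σ` of edges between the vertices
`0, …, n - 1` has been read from its first to its last element. -/
noncomputable def memoryAfter (A : StreamingAlgorithm) (n : ℕ) (σ : List (Fin n × Fin n)) :
    PMF (List Bool) :=
  σ.foldl
    (fun μ e => μ.bind fun q =>
      (randomBits (A.coins n)).map fun ω => A.update n q (e.1.val, e.2.val) ω)
    ((randomBits (A.coins n)).map fun ω => A.init n ω)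

/-- The distribution of the value that is output after one pass over the stream `σ`. -/
noncomputable def outputDist (A : StreamingAlgorithm) (n : ℕ) (σ : List (Fin n × Fin n)) :
    PMF ℝ :=
  (A.memoryAfter n σ).bind fun q =>
    (randomBits (A.coins n)).map fun ω =>
      ((A.output n q ω).1 : ℝ) / (((A.output n q ω).2 : ℝ) + 1)

/-- At every moment of the pass over `σ` and for all outcomes of the random bits, the memory
consists of at most `s` bits. -/
def UsesSpaceAtMost (A : StreamingAlgorithm) (n : ℕ) (σ : List (Fin n × Fin n)) (s : ℝ) : Prop :=
  ∀ τ : List (Fin n × Fin n), τ <+: σ →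
    ∀ q ∈ (A.memoryAfter n τ).support, (q.length : ℝ) ≤ s

/-- On the stream `σ` of the edges of `G`, with probability at least `99%` the output lies
between `α` times the Max-DICUT value of `G` and the Max-DICUT value of `G`. -/
def ApproximatesMaxDicut (A : StreamingAlgorithm) {n : ℕ} (G : DiMultigraph (Fin n))
    (σ : List (Fin n × Fin n)) (α : ℝ) : Prop :=
  (99 / 100 : ℝ≥0∞) ≤
    (A.outputDist n σ).toOuterMeasure {v : ℝ | α * G.maxVal ≤ v ∧ v ≤ G.maxVal}

end StreamingAlgorithm

/-!
# A `(1/2 - ε)`-approximation of Max-DICUT in sublinear space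

*A local algorithm.* Write the cut value of a fractional assignment `x : V → [0, 1]` as
`F x = ∑ x u * (1 - x v)`, the sum over all edges `(u, v)`. Double greedy moves a lower trajectory
`x`, starting at `0`, and an upper trajectory `y`, starting at `1`, towards each other. If all
vertices move simultaneously with speeds given by the current slopes of `F` at `x` and at `y`, then
`F x + F y + 2 * F o` does not decrease, where `o` is an optimal assignment clamped between `x` and
`y`; hence the common end point has at least half of the maximal value. `traj` discretizes this
flow into a constant number of rounds in exact natural number arithmetic, at the cost of a small
fraction of the edges (`potential_succ`, `cut_traj_ge`). Conversely `F` is affine in each coordinate,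
so fractional values never exceed the maximum (`exists_rounding`). The final cut value is
thus a good approximation of the Max-DICUT value (`estimate_mem`), and it is a sum over the edges
of terms that depend only on a ball of constant radius around the edge (`edgeWeight_congr`). No
randomness is involved so far.

*Sampling.* Every vertex is sampled with probability `n ^ (-δ)` for a small constant `δ`, and the
edges with a sampled endpoint are stored. Whether the ball of an edge is sampled, and if so, what
the ball is, can be read off from the stored edges (`estimate_wanted`), so the Horvitz–Thompson
estimator for the cut value is available. To keep the random bits in memory, vertices are sampled
in buckets (residue classes), independently for different buckets; the probability that a ball is
sampled then depends on the number of buckets that it meets, which the algorithm can see. Two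
edges are dependent only if their balls meet a common bucket, and there are few such pairs
(`card_not_disjoint_le`). Chebyshev's inequality applies as soon as the number of edges is a large
multiple of the number of buckets (`card_deviation_le`); smaller graphs are stored completely.
Markov's inequality shows that the stored edges rarely exceed the reserved space
(`card_overflow_le`).
-/

namespace LocalDicut

/-! ### A deterministic local algorithm: discretized continuous double greedy -/

/-- The edges of the list `L` that are incident to `u`. -/
def inc (L : List (ℕ × ℕ)) (u : ℕ) : List (ℕ × ℕ) :=
  L.filter fun e => e.1 = u ∨ e.2 = u

/-- The sum of `Q - x v` over the edges `(u, v)` of `L`. -/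
def outSlack (Q : ℕ) (L : List (ℕ × ℕ)) (x : ℕ → ℕ) (u : ℕ) : ℕ :=
  ((inc L u).map fun e => if e.1 = u then Q - x e.2 else 0).sum

/-- The sum of `x v` over the edges `(v, u)` of `L`. -/
def inLoad (L : List (ℕ × ℕ)) (x : ℕ → ℕ) (u : ℕ) : ℕ :=
  ((inc L u).map fun e => if e.2 = u then x e.1 else 0).sum

/-- The positive part of the slope of the cut function at `x` in the direction of `u`. -/
def upSlope (Q : ℕ) (L : List (ℕ × ℕ)) (x : ℕ → ℕ) (u : ℕ) : ℕ :=
  outSlack Q L x u - inLoad L x u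

/-- The negative part of the slope of the cut function at `x` in the direction of `u`. -/
def downSlope (Q : ℕ) (L : List (ℕ × ℕ)) (x : ℕ → ℕ) (u : ℕ) : ℕ :=
  inLoad L x u - outSlack Q L x u

/-- The lower trajectory of the discretized double greedy algorithm after `i` of its `P` rounds.
The values are multiples of `1 / P ^ 2`, stored as natural numbers at most `P ^ 2`. The upper
trajectory after `i` rounds is `traj P L i + (P - i) * P`. -/
def traj (P : ℕ) (L : List (ℕ × ℕ)) : ℕ → ℕ → ℕ
  | 0, _ => 0
  | i + 1, u =>
    traj P L i u +
      P * upSlope (P ^ 2) L (traj P L i) u /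
        (upSlope (P ^ 2) L (traj P L i) u +
          downSlope (P ^ 2) L (fun v => traj P L i v + (P - i) * P) u)

/-- The value of the fractional assignment `z / Q`, scaled by `Q ^ 2`. -/
def cut (Q : ℝ) (L : List (ℕ × ℕ)) (z : ℕ → ℝ) : ℝ :=
  (L.map fun e => z e.1 * (Q - z e.2)).sum

/-- The partial derivative of `cut Q L` at `z` in the direction of `u`. -/
def slope (Q : ℝ) (L : List (ℕ × ℕ)) (z : ℕ → ℝ) (u : ℕ) : ℝ :=
  (L.map fun e => (if e.1 = u then Q - z e.2 else 0) - (if e.2 = u then z e.1 else 0)).sum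

lemma cut_add (Q : ℝ) (n : ℕ) (z d : ℕ → ℝ) (L : List (ℕ × ℕ))
    (hL : ∀ e ∈ L, e.1 < n ∧ e.2 < n) :
    cut Q L (z + d) = cut Q L z + ∑ u ∈ Finset.range n, d u * slope Q L z u
      - (L.map fun e => d e.1 * d e.2).sum := by
  induction L with
  | nil => simp [cut, slope]
  | cons e L ih =>
    have h1 := ih fun f hf => hL f (List.mem_cons_of_mem _ hf)
    have h2 := hL e List.mem_cons_self
    simp only [cut, slope, List.map_cons, List.sum_cons, Pi.add_apply, mul_add,
      Finset.sum_add_distrib] at h1 ⊢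
    rw [h1]
    have h3 : ∑ u ∈ Finset.range n,
        d u * ((if e.1 = u then Q - z e.2 else 0) - (if e.2 = u then z e.1 else 0)) =
        d e.1 * (Q - z e.2) - d e.2 * z e.1 := by
      simp [mul_sub, Finset.sum_sub_distrib, h2.1, h2.2]
    rw [h3]
    ring

lemma cut_add_ge (Q B : ℝ) (n : ℕ) (z d : ℕ → ℝ) (L : List (ℕ × ℕ))
    (hL : ∀ e ∈ L, e.1 < n ∧ e.2 < n) (hd : ∀ u, |d u| ≤ B) :
    cut Q L z + ∑ u ∈ Finset.range n, d u * slope Q L z u - B ^ 2 * L.length ≤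
      cut Q L (z + d) := by
  rw [cut_add Q n z d L hL]
  have : (L.map fun e => d e.1 * d e.2).sum ≤ B ^ 2 * L.length := by
    have := List.sum_le_card_nsmul (L.map fun e => d e.1 * d e.2) (B ^ 2) (by
      intro y hy
      obtain ⟨e, -, rfl⟩ := List.mem_map.1 hy
      calc d e.1 * d e.2 ≤ |d e.1 * d e.2| := le_abs_self _
        _ = |d e.1| * |d e.2| := abs_mul _ _
        _ ≤ B * B := mul_le_mul (hd _) (hd _) (abs_nonneg _) ((abs_nonneg _).trans (hd e.1))
        _ = B ^ 2 := by ring)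
    simpa [mul_comm] using this
  linarith

lemma slope_anti (Q : ℝ) (L : List (ℕ × ℕ)) {z w : ℕ → ℝ} (h : ∀ v, z v ≤ w v) (u : ℕ) :
    slope Q L w u ≤ slope Q L z u := by
  refine List.sum_le_sum fun e _ => ?_
  have := h e.1
  have := h e.2
  split_ifs <;> linarith

lemma outSlack_cast (Q : ℕ) (L : List (ℕ × ℕ)) (x : ℕ → ℕ) (hx : ∀ v, x v ≤ Q) (u : ℕ) :
    (outSlack Q L x u : ℝ) = (L.map fun e => if e.1 = u then (Q : ℝ) - x e.2 else 0).sum := by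
  unfold outSlack inc
  induction L with
  | nil => simp
  | cons e L ih =>
    rw [List.map_cons, List.sum_cons, ← ih]
    by_cases h1 : e.1 = u
    · simp [h1, Nat.cast_sub (hx e.2)]
    · by_cases h2 : e.2 = u <;> simp [h1, h2]

lemma inLoad_cast (L : List (ℕ × ℕ)) (x : ℕ → ℕ) (u : ℕ) :
    (inLoad L x u : ℝ) = (L.map fun e => if e.2 = u then (x e.1 : ℝ) else 0).sum := by
  unfold inLoad inc
  induction L with
  | nil => simp
  | cons e L ih =>
    rw [List.map_cons, List.sum_cons, ← ih]
    by_cases h2 : e.2 = u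
    · simp [h2]
    · by_cases h1 : e.1 = u <;> simp [h1, h2]

lemma slope_cast (Q : ℕ) (L : List (ℕ × ℕ)) (x : ℕ → ℕ) (hx : ∀ v, x v ≤ Q) (u : ℕ) :
    slope Q L (fun v => (x v : ℝ)) u = (outSlack Q L x u : ℝ) - inLoad L x u := by
  rw [outSlack_cast Q L x hx, inLoad_cast, slope]
  induction L with
  | nil => simp
  | cons e L ih =>
    simp only [List.map_cons, List.sum_cons, ih]
    ring

lemma upSlope_cast (Q : ℕ) (L : List (ℕ × ℕ)) (x : ℕ → ℕ) (hx : ∀ v, x v ≤ Q) (u : ℕ) :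
    (upSlope Q L x u : ℝ) = max (slope Q L (fun v => (x v : ℝ)) u) 0 := by
  rw [slope_cast Q L x hx, upSlope]
  rcases le_total (inLoad L x u) (outSlack Q L x u) with h | h
  · rw [Nat.cast_sub h, max_eq_left]
    simpa using (Nat.cast_le (α := ℝ)).2 h
  · rw [Nat.sub_eq_zero_of_le h, max_eq_right]
    · simp
    · simpa using (Nat.cast_le (α := ℝ)).2 h

lemma downSlope_cast (Q : ℕ) (L : List (ℕ × ℕ)) (x : ℕ → ℕ) (hx : ∀ v, x v ≤ Q) (u : ℕ) :
    (downSlope Q L x u : ℝ) = max (-slope Q L (fun v => (x v : ℝ)) u) 0 := by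
  rw [slope_cast Q L x hx, downSlope, neg_sub]
  rcases le_total (outSlack Q L x u) (inLoad L x u) with h | h
  · rw [Nat.cast_sub h, max_eq_left]
    simpa using (Nat.cast_le (α := ℝ)).2 h
  · rw [Nat.sub_eq_zero_of_le h, max_eq_right]
    · simp
    · simpa using (Nat.cast_le (α := ℝ)).2 h

lemma sum_upSlope_le (Q n : ℕ) (L : List (ℕ × ℕ)) (x : ℕ → ℕ)
    (hL : ∀ e ∈ L, e.1 < n ∧ e.2 < n) :
    ∑ u ∈ Finset.range n, upSlope Q L x u ≤ Q * L.length := by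
  calc ∑ u ∈ Finset.range n, upSlope Q L x u
      ≤ ∑ u ∈ Finset.range n, (L.map fun e => if e.1 = u then Q else 0).sum := by
        refine Finset.sum_le_sum fun u _ => (Nat.sub_le _ _).trans ?_
        unfold outSlack inc
        induction L with
        | nil => simp
        | cons e L ih =>
          have := ih fun f hf => hL f (List.mem_cons_of_mem _ hf)
          by_cases h1 : e.1 = u
          · simp only [h1, true_or, decide_true, List.filter_cons_of_pos, List.map_cons,
              if_true, List.sum_cons]
            omega
          · by_cases h2 : e.2 = u <;> simpa [h1, h2] using this
    _ = Q * L.length := by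
        clear x
        induction L with
        | nil => simp
        | cons e L ih =>
          have h1 := ih fun f hf => hL f (List.mem_cons_of_mem _ hf)
          have h2 := hL e List.mem_cons_self
          simp only [List.map_cons, List.sum_cons, Finset.sum_add_distrib, h1,
            List.length_cons]
          simp [h2.1]
          ring

/-- The first-order change of the potential contributed by a single vertex. With the exact
quotient `P * A / (A + B)` it would be nonnegative; the floor costs `3 * A`. Here `sx`, `so`, `sy`
are the slopes at the lower trajectory, at the moving optimum and at the upper trajectory. -/
lemma vertex_change (P A B k : ℕ) (sx so sy : ℝ) (hk : k = P * A / (A + B))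
    (hA : (A : ℝ) = max sx 0) (hB : (B : ℝ) = max (-sy) 0) (h1 : sy ≤ so) (h2 : so ≤ sx)
    (opt : Bool) :
    -(3 * (A : ℝ)) ≤ (k : ℝ) * sx + ((k : ℝ) - P) * sy
      + 2 * ((if opt then (k : ℝ) - P else k) * so) := by
  have hkP : (k : ℝ) ≤ P := by
    rw [hk]
    have : P * A / (A + B) ≤ P := by
      rcases Nat.eq_zero_or_pos (A + B) with h | h
      · simp [h]
      · exact Nat.div_le_of_le_mul (by nlinarith [Nat.zero_le (P * B)])
    exact_mod_cast this
  have hk0 : (0 : ℝ) ≤ k := Nat.cast_nonneg k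
  have hA0 : (0 : ℝ) ≤ A := Nat.cast_nonneg A
  have hP0 : (0 : ℝ) ≤ P := Nat.cast_nonneg P
  rcases le_or_gt sx 0 with hx | hx
  · -- nothing to gain from raising the vertex: `k = 0`
    have hAz : A = 0 := by
      rw [max_eq_right hx] at hA
      exact_mod_cast hA
    subst hAz
    have hkz : k = 0 := by simpa using hk
    subst hkz
    cases opt <;> simp <;> nlinarith
  · rw [max_eq_left hx.le] at hA
    have hApos : 0 < A := by
      rw [← hA] at hx
      exact_mod_cast hx
    rcases le_or_gt 0 sy with hy | hy
    · -- nothing to gain from lowering the vertex: `k = P`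
      have hBz : B = 0 := by
        rw [max_eq_right (by linarith)] at hB
        exact_mod_cast hB
      subst hBz
      have hkz : k = P := by
        rw [hk, Nat.add_zero, Nat.mul_div_cancel _ hApos]
      subst hkz
      cases opt <;> simp <;> nlinarith
    · rw [max_eq_left (by linarith)] at hB
      have hs : 0 < A + B := by omega
      have l1 : (k : ℝ) * (A + B) ≤ P * A := by
        have := Nat.div_mul_le_self (P * A) (A + B)
        rw [← hk] at this
        exact_mod_cast this
      have l2 : (P : ℝ) * A ≤ (k + 1) * (A + B) := by
        have := (Nat.lt_div_mul_add (a := P * A) hs).le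
        rw [← hk] at this
        have h3 : P * A ≤ (k + 1) * (A + B) := by linarith
        exact_mod_cast h3
      have hs' : (0 : ℝ) < A + B := by exact_mod_cast hs
      have hB0 : (0 : ℝ) ≤ B := Nat.cast_nonneg B
      have esx : sx = A := hA.symm
      have esy : sy = -B := by linarith
      subst esx esy
      -- it suffices to prove the bound after multiplication with `A + B > 0`
      refine le_of_mul_le_mul_right ?_ hs'
      have hsq : 0 ≤ (P : ℝ) * ((A : ℝ) - B) ^ 2 := by positivity
      cases opt
      · have : -((B : ℝ) * k) ≤ k * so := by nlinarith
        simp only [Bool.false_eq_true, if_false]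
        have h5 : (k : ℝ) * (A + B) * B ≤ P * A * B := mul_le_mul_of_nonneg_right l1 hB0
        have h6 : (P : ℝ) * A * A ≤ (k + 1) * (A + B) * A := mul_le_mul_of_nonneg_right l2 hA0
        nlinarith [mul_le_mul_of_nonneg_right this hs'.le, mul_nonneg hA0 hB0]
      · have : ((k : ℝ) - P) * A ≤ (k - P) * so := by nlinarith
        simp only [if_true]
        have h5 : (k : ℝ) * (A + B) * B ≤ P * A * B := mul_le_mul_of_nonneg_right l1 hB0
        have h6 : (P : ℝ) * A * A ≤ (k + 1) * (A + B) * A := mul_le_mul_of_nonneg_right l2 hA0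
        nlinarith [mul_le_mul_of_nonneg_right this hs'.le, mul_nonneg hA0 hB0]

lemma traj_le (P : ℕ) (L : List (ℕ × ℕ)) (i u : ℕ) : traj P L i u ≤ i * P := by
  induction i with
  | zero => simp [traj]
  | succ i ih =>
    rw [traj, Nat.succ_mul]
    refine Nat.add_le_add ih ?_
    set A := upSlope (P ^ 2) L (traj P L i) u
    set B := downSlope (P ^ 2) L (fun v => traj P L i v + (P - i) * P) u
    rcases Nat.eq_zero_or_pos (A + B) with h | h
    · simp [h]
    · exact Nat.div_le_of_le_mul (by nlinarith [Nat.zero_le (P * B)])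

lemma traj_add_gap_le (P : ℕ) (L : List (ℕ × ℕ)) (i u : ℕ) (hi : i ≤ P) :
    traj P L i u + (P - i) * P ≤ P ^ 2 := by
  have h1 := traj_le P L i u
  calc traj P L i u + (P - i) * P ≤ i * P + (P - i) * P := by omega
    _ = (i + (P - i)) * P := by ring
    _ = P ^ 2 := by rw [Nat.add_sub_cancel' hi, sq]

/-- The position of the assignment `opt` after `i` rounds: it is clamped between the lower and the
upper trajectory. -/
def hybrid (P : ℕ) (L : List (ℕ × ℕ)) (opt : ℕ → Bool) (i v : ℕ) : ℝ :=
  traj P L i v + if opt v then (((P - i) * P : ℕ) : ℝ) else 0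

/-- The potential of the double greedy algorithm after `i` rounds. -/
def potential (P : ℕ) (L : List (ℕ × ℕ)) (opt : ℕ → Bool) (i : ℕ) : ℝ :=
  cut (P ^ 2 : ℕ) L (fun v => (traj P L i v : ℝ))
    + cut (P ^ 2 : ℕ) L (fun v => ((traj P L i v + (P - i) * P : ℕ) : ℝ))
    + 2 * cut (P ^ 2 : ℕ) L (hybrid P L opt i)

lemma potential_succ (P n : ℕ) (L : List (ℕ × ℕ)) (hL : ∀ e ∈ L, e.1 < n ∧ e.2 < n)
    (opt : ℕ → Bool) (i : ℕ) (hi : i < P) :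
    potential P L opt i - 7 * (P : ℝ) ^ 2 * L.length ≤ potential P L opt (i + 1) := by
  set x := traj P L i with hx
  set y : ℕ → ℕ := fun v => x v + (P - i) * P with hy
  set A : ℕ → ℕ := fun u => upSlope (P ^ 2) L x u with hA
  set B : ℕ → ℕ := fun u => downSlope (P ^ 2) L y u with hB
  set k : ℕ → ℕ := fun u => P * A u / (A u + B u) with hk
  have hgap : (P - i) * P = (P - (i + 1)) * P + P := by
    have : P - i = P - (i + 1) + 1 := by omega
    rw [this]; ring
  have hgap' : (((P - (i + 1)) * P : ℕ) : ℝ) = (((P - i) * P : ℕ) : ℝ) - P := by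
    rw [hgap]; push_cast; ring
  have hkP : ∀ u, k u ≤ P := fun u => by
    rcases Nat.eq_zero_or_pos (A u + B u) with h | h
    · simp [hk, h]
    · exact Nat.div_le_of_le_mul (by nlinarith [Nat.zero_le (P * B u)])
  have hkP' : ∀ u, (k u : ℝ) ≤ P := fun u => by exact_mod_cast hkP u
  have hk0 : ∀ u, (0 : ℝ) ≤ k u := fun u => Nat.cast_nonneg _
  have hx1 : ∀ u, traj P L (i + 1) u = x u + k u := fun u => rfl
  have hyQ : ∀ v, y v ≤ P ^ 2 := fun v => traj_add_gap_le P L i v hi.le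
  have hxQ : ∀ v, x v ≤ P ^ 2 := fun v => (Nat.le_add_right _ _).trans (hyQ v)
  have e1 : (fun v => (traj P L (i + 1) v : ℝ)) = (fun v => (x v : ℝ)) + fun v => (k v : ℝ) := by
    funext v; simp [hx1]
  have e2 : (fun v => ((traj P L (i + 1) v + (P - (i + 1)) * P : ℕ) : ℝ)) =
      (fun v => (y v : ℝ)) + fun v => (k v : ℝ) - P := by
    funext v
    rw [Pi.add_apply, hx1, Nat.cast_add, hgap', hy]
    push_cast
    ring
  have e3 : hybrid P L opt (i + 1) =
      hybrid P L opt i + fun v => if opt v then (k v : ℝ) - P else k v := by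
    funext v
    simp only [hybrid, Pi.add_apply, hx1, hgap', ← hx]
    split_ifs <;> push_cast <;> ring
  have b1 := cut_add_ge (P ^ 2 : ℕ) P n (fun v => (x v : ℝ)) (fun v => (k v : ℝ)) L hL
    (fun u => by rw [abs_of_nonneg (hk0 u)]; exact hkP' u)
  have b2 := cut_add_ge (P ^ 2 : ℕ) P n (fun v => (y v : ℝ)) (fun v => (k v : ℝ) - P) L hL
    (fun u => by rw [abs_le]; constructor <;> linarith [hk0 u, hkP' u])
  have b3 := cut_add_ge (P ^ 2 : ℕ) P n (hybrid P L opt i)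
    (fun v => if opt v then (k v : ℝ) - P else k v) L hL
    (fun u => by
      rw [abs_le]
      split_ifs <;> constructor <;> linarith [hk0 u, hkP' u])
  have hsum : -(3 * ((P : ℝ) ^ 2 * L.length)) ≤
      ∑ u ∈ Finset.range n, (k u : ℝ) * slope (P ^ 2 : ℕ) L (fun v => (x v : ℝ)) u
      + ∑ u ∈ Finset.range n, ((k u : ℝ) - P) * slope (P ^ 2 : ℕ) L (fun v => (y v : ℝ)) u
      + 2 * ∑ u ∈ Finset.range n, (if opt u then (k u : ℝ) - P else k u) *
          slope (P ^ 2 : ℕ) L (hybrid P L opt i) u := by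
    rw [Finset.mul_sum, ← Finset.sum_add_distrib, ← Finset.sum_add_distrib]
    have h1 : ∑ u ∈ Finset.range n, -(3 * (A u : ℝ)) ≤ ∑ u ∈ Finset.range n,
        ((k u : ℝ) * slope (P ^ 2 : ℕ) L (fun v => (x v : ℝ)) u
          + ((k u : ℝ) - P) * slope (P ^ 2 : ℕ) L (fun v => (y v : ℝ)) u
          + 2 * ((if opt u then (k u : ℝ) - P else k u) *
          slope (P ^ 2 : ℕ) L (hybrid P L opt i) u)) := by
      refine Finset.sum_le_sum fun u _ => vertex_change P (A u) (B u) (k u) _ _ _ rfl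
        (upSlope_cast _ L x hxQ u) (downSlope_cast _ L y hyQ u)
        (slope_anti _ L (fun v => ?_) u) (slope_anti _ L (fun v => ?_) u) (opt u)
      · simp only [hybrid, hy, ← hx]
        split_ifs
        · push_cast; linarith
        · push_cast; nlinarith [Nat.cast_nonneg (α := ℝ) (P - i), Nat.cast_nonneg (α := ℝ) P]
      · simp only [hybrid, ← hx]
        split_ifs
        · linarith [Nat.cast_nonneg (α := ℝ) ((P - i) * P)]
        · linarith
    refine le_trans ?_ h1
    rw [Finset.sum_neg_distrib, ← Finset.mul_sum]
    have h2 : ((∑ u ∈ Finset.range n, A u : ℕ) : ℝ) ≤ ((P ^ 2 * L.length : ℕ) : ℝ) := by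
      exact_mod_cast sum_upSlope_le (P ^ 2) n L x hL
    push_cast at h2
    linarith
  unfold potential
  rw [e1, e2, e3]
  linarith

/-- The discretized double greedy algorithm is a `1/2`-approximation up to the additive
error `7 / (4 * P)` per edge. -/
theorem cut_traj_ge (P n : ℕ) (L : List (ℕ × ℕ)) (hL : ∀ e ∈ L, e.1 < n ∧ e.2 < n)
    (opt : ℕ → Bool) :
    2 * cut (P ^ 2 : ℕ) L (fun v => if opt v then ((P ^ 2 : ℕ) : ℝ) else 0)
        - 7 * (P : ℝ) ^ 3 * L.length ≤
      4 * cut (P ^ 2 : ℕ) L (fun v => (traj P L P v : ℝ)) := by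
  have hpot : ∀ i ≤ P, potential P L opt 0 - i * (7 * (P : ℝ) ^ 2 * L.length) ≤
      potential P L opt i := by
    intro i
    induction i with
    | zero => simp
    | succ i ih =>
      intro hi
      have h1 := ih (by omega)
      have h2 := potential_succ P n L hL opt i hi
      push_cast
      linarith
  have h0 := hpot P le_rfl
  have hyb0 : hybrid P L opt 0 = fun v => if opt v then ((P ^ 2 : ℕ) : ℝ) else 0 := by
    funext v
    simp [hybrid, traj, sq]
  have hyb1 : hybrid P L opt P = fun v => (traj P L P v : ℝ) := by
    funext v
    simp [hybrid]
  have c0 : cut (P ^ 2 : ℕ) L (fun v => (traj P L 0 v : ℝ)) = 0 := by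
    simp [cut, traj]
  have c1 : cut (P ^ 2 : ℕ) L (fun v => ((traj P L 0 v + (P - 0) * P : ℕ) : ℝ)) = 0 := by
    simp [cut, traj, sq]
  unfold potential at h0
  rw [hyb0, hyb1, c0, c1] at h0
  simp only [Nat.sub_self, Nat.zero_mul, Nat.add_zero] at h0
  linarith

/-! ### Rounding fractional assignments, and the Max-DICUT value -/

lemma cut_update (Q : ℝ) (L : List (ℕ × ℕ)) (hL : ∀ e ∈ L, e.1 ≠ e.2) (z : ℕ → ℝ) (u : ℕ) :
    Q * cut Q L z = z u * cut Q L (Function.update z u Q)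
      + (Q - z u) * cut Q L (Function.update z u 0) := by
  induction L with
  | nil => simp [cut]
  | cons e L ih =>
    have h1 := ih fun f hf => hL f (List.mem_cons_of_mem _ hf)
    have h2 := hL e List.mem_cons_self
    simp only [cut, List.map_cons, List.sum_cons, mul_add] at h1 ⊢
    rw [h1]
    have h3 : Q * (z e.1 * (Q - z e.2)) =
        z u * (Function.update z u Q e.1 * (Q - Function.update z u Q e.2)) +
        (Q - z u) * (Function.update z u 0 e.1 * (Q - Function.update z u 0 e.2)) := by
      simp only [Function.update_apply]
      by_cases ha : e.1 = u
      · have hb : e.2 ≠ u := fun hb => h2 (ha.trans hb.symm)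
        simp only [ha, hb, if_true, if_false]
        ring
      · by_cases hb : e.2 = u
        · simp only [ha, hb, if_true, if_false]
          ring
        · simp only [ha, hb, if_false]
          ring
    rw [h3]
    ring

/-- Coordinates of a fractional assignment can be rounded one after the other without decreasing
the value of the cut, because the cut function is affine in each coordinate. -/
lemma exists_rounding {Q : ℝ} (hQ : 0 < Q) (L : List (ℕ × ℕ)) (hL : ∀ e ∈ L, e.1 ≠ e.2)
    (z : ℕ → ℝ) (h0 : ∀ v, 0 ≤ z v) (h1 : ∀ v, z v ≤ Q) (s : Finset ℕ) :
    ∃ b : ℕ → Bool,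
      cut Q L z ≤ cut Q L (fun v => if v ∈ s then (if b v then Q else 0) else z v) := by
  induction s using Finset.induction_on with
  | empty => exact ⟨fun _ => true, by simp⟩
  | insert u s hu ih =>
    obtain ⟨b, hb⟩ := ih
    set w : ℕ → ℝ := fun v => if v ∈ s then (if b v then Q else 0) else z v with hw
    have hup := cut_update Q L hL w u
    have hwu : w u = z u := by simp [hw, hu]
    have key : ∃ c : Bool, cut Q L w ≤ cut Q L (Function.update w u (if c then Q else 0)) := by
      by_contra hcon
      push Not at hcon
      have ht := hcon true
      have hf := hcon false
      simp only [if_true, Bool.false_eq_true, if_false] at ht hf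
      have a0 := h0 u
      have a1 := h1 u
      rw [hwu] at hup
      rcases lt_or_eq_of_le a0 with h | h
      · nlinarith [mul_lt_mul_of_pos_left ht h,
          mul_le_mul_of_nonneg_left hf.le (sub_nonneg.2 a1)]
      · rw [← h] at hup
        nlinarith
    obtain ⟨c, hc⟩ := key
    refine ⟨Function.update b u c, hb.trans (hc.trans (le_of_eq ?_))⟩
    congr 1
    funext v
    by_cases hv : v = u
    · subst hv; simp
    · simp [hv, hw]

lemma cut_bool (Q : ℝ) (L : List (ℕ × ℕ)) (b : ℕ → Bool) :
    cut Q L (fun v => if b v then Q else 0) =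
      Q ^ 2 * (L.countP fun e => b e.1 = true ∧ b e.2 = false : ℕ) := by
  induction L with
  | nil => simp [cut]
  | cons e L ih =>
    simp only [cut, List.map_cons, List.sum_cons, List.countP_cons] at ih ⊢
    rw [ih]
    cases h1 : b e.1 <;> cases h2 : b e.2 <;> simp
    ring

lemma cut_congr (Q : ℝ) (n : ℕ) (L : List (ℕ × ℕ)) (hL : ∀ e ∈ L, e.1 < n ∧ e.2 < n)
    {z w : ℕ → ℝ} (h : ∀ v < n, z v = w v) : cut Q L z = cut Q L w := by
  unfold cut
  congr 1
  refine List.map_congr_left fun e he => ?_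
  rw [h _ (hL e he).1, h _ (hL e he).2]

/-- An edge stream on the vertices `Fin n`, with the vertices regarded as natural numbers. -/
def natEdges {n : ℕ} (σ : List (Fin n × Fin n)) : List (ℕ × ℕ) :=
  σ.map fun e => (e.1.val, e.2.val)

lemma natEdges_lt {n : ℕ} (σ : List (Fin n × Fin n)) :
    ∀ e ∈ natEdges σ, e.1 < n ∧ e.2 < n := by
  intro e he
  obtain ⟨f, -, rfl⟩ := List.mem_map.1 he
  exact ⟨f.1.2, f.2.2⟩

section
variable {n : ℕ} {G : DiMultigraph (Fin n)} {σ : List (Fin n × Fin n)} (hσ : G.IsOrdering σ)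
include hσ

lemma natEdges_ne : ∀ e ∈ natEdges σ, e.1 ≠ e.2 := by
  intro e he
  obtain ⟨f, hf, rfl⟩ := List.mem_map.1 he
  have : f ∈ G.edges := by rw [← hσ]; exact hf
  exact fun h => G.loopless f this (Fin.ext h)

lemma length_natEdges : (natEdges σ).length = G.edges.card := by
  rw [← hσ]; simp [natEdges]

lemma cut_bool_eq_val (Q : ℝ) (b : ℕ → Bool) :
    cut Q (natEdges σ) (fun v => if b v then Q else 0) =
      Q ^ 2 * ((natEdges σ).length * G.val fun v => b v) := by
  rw [cut_bool, DiMultigraph.val, length_natEdges hσ]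
  have h : (natEdges σ).countP (fun e => b e.1 = true ∧ b e.2 = false) =
      G.edges.countP fun e => b e.1 = true ∧ b e.2 = false := by
    rw [← hσ, Multiset.coe_countP, natEdges, List.countP_map]
    rfl
  rw [h]
  rcases Nat.eq_zero_or_pos G.edges.card with h0 | h0
  · have : G.edges.countP (fun e => b e.1 = true ∧ b e.2 = false) = 0 := by
      have := Multiset.countP_le_card (fun e : Fin n × Fin n => b e.1 = true ∧ b e.2 = false)
        G.edges
      omega
    rw [this, h0]; simp
  · have : (G.edges.card : ℝ) ≠ 0 := by positivity
    field_simp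

lemma cut_le_maxVal {Q : ℝ} (hQ : 0 < Q) (z : ℕ → ℝ) (h0 : ∀ v, 0 ≤ z v) (h1 : ∀ v, z v ≤ Q) :
    cut Q (natEdges σ) z ≤ Q ^ 2 * ((natEdges σ).length * G.maxVal) := by
  obtain ⟨b, hb⟩ := exists_rounding hQ (natEdges σ) (natEdges_ne hσ) z h0 h1 (Finset.range n)
  have h2 : cut Q (natEdges σ)
      (fun v => if v ∈ Finset.range n then (if b v then Q else 0) else z v) =
      cut Q (natEdges σ) (fun v => if b v then Q else 0) :=
    cut_congr Q n _ (natEdges_lt σ) fun v hv => by simp [hv]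
  rw [h2, cut_bool_eq_val hσ] at hb
  refine hb.trans ?_
  gcongr
  exact Finset.le_sup' G.val (Finset.mem_univ _)

/-- Rounding the constant assignment `1/2` shows that a quarter of the edges can be cut. -/
lemma quarter_le_maxVal (hG : G.edges ≠ 0) : 1 / 4 ≤ G.maxVal := by
  have h := cut_le_maxVal hσ (Q := 1) one_pos (fun _ => 1 / 2) (fun _ => by norm_num)
    (fun _ => by norm_num)
  have hm : (0 : ℝ) < (natEdges σ).length := by
    rw [length_natEdges hσ]
    exact_mod_cast Multiset.card_pos.2 hG
  simp only [cut, List.map_const', List.sum_replicate, nsmul_eq_mul] at h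
  nlinarith

lemma maxVal_le_cut_traj (P : ℕ) :
    2 * ((P : ℝ) ^ 4 * ((natEdges σ).length * G.maxVal)) - 7 * (P : ℝ) ^ 3 * (natEdges σ).length ≤
      4 * cut (P ^ 2 : ℕ) (natEdges σ) (fun v => (traj P (natEdges σ) P v : ℝ)) := by
  obtain ⟨x, -, hx⟩ := Finset.exists_mem_eq_sup' (Finset.univ_nonempty (α := Fin n → Bool)) G.val
  have hb := cut_traj_ge P n (natEdges σ) (natEdges_lt σ)
    (fun v => if h : v < n then x ⟨v, h⟩ else false)
  rw [cut_bool_eq_val hσ] at hb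
  have h2 : (fun v : Fin n => if h : (v : ℕ) < n then x ⟨v, h⟩ else false) = x := by
    funext v; simp
  rw [h2, ← hx] at hb
  have h3 : ((P ^ 2 : ℕ) : ℝ) ^ 2 = (P : ℝ) ^ 4 := by push_cast; ring
  rw [h3] at hb
  exact hb

end

/-- The contribution of the edge `e` to the cut value of the fractional assignment that the local
algorithm computes on the graph with edge list `L`. -/
def edgeWeight (P : ℕ) (L : List (ℕ × ℕ)) (e : ℕ × ℕ) : ℕ :=
  traj P L P e.1 * (P ^ 2 - traj P L P e.2)

lemma traj_le_sq (P : ℕ) (L : List (ℕ × ℕ)) (u : ℕ) : traj P L P u ≤ P ^ 2 :=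
  (traj_le P L P u).trans_eq (sq P).symm

lemma edgeWeight_le (P : ℕ) (L : List (ℕ × ℕ)) (e : ℕ × ℕ) : edgeWeight P L e ≤ P ^ 4 := by
  calc edgeWeight P L e ≤ P ^ 2 * P ^ 2 := Nat.mul_le_mul (traj_le_sq P L _) (Nat.sub_le _ _)
    _ = P ^ 4 := by ring

lemma sum_edgeWeight (P : ℕ) (L : List (ℕ × ℕ)) :
    (((L.map (edgeWeight P L)).sum : ℕ) : ℝ) =
      cut (P ^ 2 : ℕ) L (fun v => (traj P L P v : ℝ)) := by
  rw [cut, Nat.cast_list_sum, List.map_map]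
  congr 1
  refine List.map_congr_left fun e _ => ?_
  simp [edgeWeight, Nat.cast_sub (traj_le_sq P L e.2)]

/-- If `est` agrees with the cut value of the local algorithm up to an additive error of one
`1 / H` fraction of the edges, then subtracting that error gives an admissible answer. -/
lemma estimate_mem {n : ℕ} {G : DiMultigraph (Fin n)} {σ : List (Fin n × Fin n)}
    (hσ : G.IsOrdering σ) (hG : G.edges ≠ 0) {ε : ℝ} {H : ℕ} (hH : 0 < H) (hHε : 12 ≤ ε * H)
    {est : ℕ}
    (h1 : H * est ≤ H * ((natEdges σ).map (edgeWeight (2 * H) (natEdges σ))).sum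
      + (2 * H) ^ 4 * (natEdges σ).length)
    (h2 : H * ((natEdges σ).map (edgeWeight (2 * H) (natEdges σ))).sum ≤ H * est
      + (2 * H) ^ 4 * (natEdges σ).length) :
    (1 / 2 - ε) * G.maxVal ≤
      ((H * est - (2 * H) ^ 4 * (natEdges σ).length : ℕ) : ℝ) /
        (((H * (2 * H) ^ 4 * (natEdges σ).length - 1 : ℕ) : ℝ) + 1) ∧
    ((H * est - (2 * H) ^ 4 * (natEdges σ).length : ℕ) : ℝ) /
        (((H * (2 * H) ^ 4 * (natEdges σ).length - 1 : ℕ) : ℝ) + 1) ≤ G.maxVal := by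
  have hq := quarter_le_maxVal hσ hG
  have hm : 0 < (natEdges σ).length := by
    rw [length_natEdges hσ]
    exact Multiset.card_pos.2 hG
  set m := (natEdges σ).length
  set S := ((natEdges σ).map (edgeWeight (2 * H) (natEdges σ))).sum with hS
  have hup := cut_le_maxVal hσ (Q := ((2 * H) ^ 2 : ℕ)) (by positivity)
    (fun v => (traj (2 * H) (natEdges σ) (2 * H) v : ℝ)) (fun v => Nat.cast_nonneg _)
    (fun v => by exact_mod_cast traj_le_sq (2 * H) (natEdges σ) v)
  have hlo := maxVal_le_cut_traj hσ (2 * H)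
  rw [← sum_edgeWeight, ← hS] at hup hlo
  have hHm : 0 < H * (2 * H) ^ 4 * m := by positivity
  have hden : (((H * (2 * H) ^ 4 * m - 1 : ℕ) : ℝ) + 1) = (H : ℝ) * (2 * H) ^ 4 * m := by
    rw [Nat.cast_sub hHm]
    push_cast
    ring
  rw [hden]
  have hH' : (0 : ℝ) < H := by exact_mod_cast hH
  have hm' : (0 : ℝ) < m := by exact_mod_cast hm
  have hpos : (0 : ℝ) < (H : ℝ) * (2 * H) ^ 4 * m := by positivity
  have r1 : (H : ℝ) * est ≤ H * S + (2 * H) ^ 4 * m := by exact_mod_cast h1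
  have r2 : (H : ℝ) * S ≤ H * est + (2 * H) ^ 4 * m := by exact_mod_cast h2
  push_cast at hup hlo
  constructor
  · rw [le_div_iff₀ hpos]
    have h3 : (H : ℝ) * est - (2 * H) ^ 4 * m ≤ ((H * est - (2 * H) ^ 4 * m : ℕ) : ℝ) := by
      rw [sub_le_iff_le_add]
      exact_mod_cast le_tsub_add
    refine le_trans ?_ h3
    have h4 : (0 : ℝ) < (2 * H : ℝ) ^ 3 * m := by positivity
    have h5 : 12 * ((2 * (H : ℝ)) ^ 4 * m) * (1 / 4) ≤ ε * H * ((2 * (H : ℝ)) ^ 4 * m) * G.maxVal := by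
      gcongr
    have h6 : (2 * (H : ℝ)) ^ 4 * m = 2 * H * ((2 * H : ℝ) ^ 3 * m) := by ring
    nlinarith
  · rw [div_le_iff₀ hpos]
    rcases le_total (H * est) ((2 * H) ^ 4 * m) with h | h
    · rw [Nat.sub_eq_zero_of_le h, Nat.cast_zero]
      have : 0 ≤ G.maxVal := by linarith
      positivity
    · rw [Nat.cast_sub h]
      push_cast
      nlinarith

/-! ### Balls: locality of the algorithm, and counting -/

/-- The vertices at distance at most `i` from `u`, listed with repetitions. -/
def ball (L : List (ℕ × ℕ)) : ℕ → ℕ → List ℕ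
  | 0, u => [u]
  | i + 1, u => u :: (inc L u).flatMap fun e => ball L i e.1 ++ ball L i e.2

/-- The ball of radius `i` around an edge, listed with repetitions. -/
def edgeBall (i : ℕ) (L : List (ℕ × ℕ)) (e : ℕ × ℕ) : List ℕ :=
  ball L i e.1 ++ ball L i e.2

lemma mem_inc {L : List (ℕ × ℕ)} {u : ℕ} {e : ℕ × ℕ} :
    e ∈ inc L u ↔ e ∈ L ∧ (e.1 = u ∨ e.2 = u) := by
  simp [inc]

lemma self_mem_ball (L : List (ℕ × ℕ)) (i u : ℕ) : u ∈ ball L i u := by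
  cases i <;> simp [ball]

lemma ball_subset_succ (L : List (ℕ × ℕ)) (i u : ℕ) : ball L i u ⊆ ball L (i + 1) u := by
  induction i generalizing u with
  | zero => simp [ball]
  | succ i ih =>
    intro w hw
    rw [ball, List.mem_cons, List.mem_flatMap] at hw ⊢
    refine hw.imp_right ?_
    rintro ⟨e, he, hwe⟩
    refine ⟨e, he, ?_⟩
    rw [List.mem_append] at hwe ⊢
    exact hwe.imp (fun h => ih _ h) (fun h => ih _ h)

section
variable {L L' : List (ℕ × ℕ)} {S : ℕ → Prop} (h : ∀ w, S w → inc L w = inc L' w)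
include h

/-- A ball is determined by the edges incident to its own vertices. -/
lemma ball_congr (i u : ℕ) (hb : ∀ w ∈ ball L i u, S w) : ball L i u = ball L' i u := by
  induction i generalizing u with
  | zero => rfl
  | succ i ih =>
    have hu := h u (hb u (self_mem_ball L _ u))
    rw [ball, ball, ← hu]
    congr 1
    refine List.flatMap_congr fun e he => ?_
    have hsub : ∀ w ∈ ball L i e.1 ++ ball L i e.2, S w := fun w hw => hb w (by
      rw [ball]
      exact List.mem_cons_of_mem _ (List.mem_flatMap.2 ⟨e, he, hw⟩))
    rw [ih e.1 fun w hw => hsub w (List.mem_append_left _ hw),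
      ih e.2 fun w hw => hsub w (List.mem_append_right _ hw)]

/-- After `i` rounds, the value of a vertex is determined by the edges incident to its ball of
radius `i`. -/
lemma traj_congr (P i u : ℕ) (hb : ∀ w ∈ ball L i u, S w) : traj P L i u = traj P L' i u := by
  induction i generalizing u with
  | zero => rfl
  | succ i ih =>
    have hu := h u (hb u (self_mem_ball L _ u))
    have hself : traj P L i u = traj P L' i u := ih u fun w hw => hb w (ball_subset_succ L i u hw)
    have hnb : ∀ e ∈ inc L u, traj P L i e.1 = traj P L' i e.1 ∧
        traj P L i e.2 = traj P L' i e.2 := by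
      intro e he
      have hsub : ∀ w ∈ ball L i e.1 ++ ball L i e.2, S w := fun w hw => hb w (by
        rw [ball]
        exact List.mem_cons_of_mem _ (List.mem_flatMap.2 ⟨e, he, hw⟩))
      exact ⟨ih e.1 fun w hw => hsub w (List.mem_append_left _ hw),
        ih e.2 fun w hw => hsub w (List.mem_append_right _ hw)⟩
    have hout : ∀ c, outSlack (P ^ 2) L (fun v => traj P L i v + c) u =
        outSlack (P ^ 2) L' (fun v => traj P L' i v + c) u := by
      intro c
      rw [outSlack, outSlack, ← hu]
      congr 1
      exact List.map_congr_left fun e he => by rw [(hnb e he).2]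
    have hin : ∀ c, inLoad L (fun v => traj P L i v + c) u =
        inLoad L' (fun v => traj P L' i v + c) u := by
      intro c
      rw [inLoad, inLoad, ← hu]
      congr 1
      exact List.map_congr_left fun e he => by rw [(hnb e he).1]
    have hout0 := hout 0
    have hin0 := hin 0
    simp only [Nat.add_zero] at hout0 hin0
    rw [traj, traj, hself, upSlope, upSlope, downSlope, downSlope, hout, hin, hout0, hin0]

lemma edgeBall_congr (i : ℕ) (e : ℕ × ℕ) (hb : ∀ w ∈ edgeBall i L e, S w) :
    edgeBall i L e = edgeBall i L' e := by
  rw [edgeBall, edgeBall, ball_congr h i e.1 fun w hw => hb w (List.mem_append_left _ hw),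
    ball_congr h i e.2 fun w hw => hb w (List.mem_append_right _ hw)]

lemma edgeWeight_congr (P : ℕ) (e : ℕ × ℕ) (hb : ∀ w ∈ edgeBall P L e, S w) :
    edgeWeight P L e = edgeWeight P L' e := by
  rw [edgeWeight, edgeWeight,
    traj_congr h P P e.1 fun w hw => hb w (List.mem_append_left _ hw),
    traj_congr h P P e.2 fun w hw => hb w (List.mem_append_right _ hw)]

end

/-- An upper bound for the number of vertices, with repetitions, in a ball of radius `i` if all
degrees are at most `D`. -/
def ballBound (D : ℕ) : ℕ → ℕ
  | 0 => 1
  | i + 1 => 1 + 2 * D * ballBound D i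

lemma length_ball_le {D : ℕ} {L : List (ℕ × ℕ)} (hD : ∀ u, (inc L u).length ≤ D) (i u : ℕ) :
    (ball L i u).length ≤ ballBound D i := by
  induction i generalizing u with
  | zero => simp [ball, ballBound]
  | succ i ih =>
    rw [ball, ballBound, List.length_cons, List.length_flatMap, Nat.add_comm]
    refine Nat.add_le_add_left ?_ 1
    have h1 := List.sum_le_card_nsmul
      ((inc L u).map fun e => (ball L i e.1 ++ ball L i e.2).length) (2 * ballBound D i) (by
        intro y hy
        obtain ⟨e, -, rfl⟩ := List.mem_map.1 hy
        rw [List.length_append, two_mul]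
        exact Nat.add_le_add (ih _) (ih _))
    refine h1.trans ?_
    rw [List.length_map, smul_eq_mul]
    calc (inc L u).length * (2 * ballBound D i) ≤ D * (2 * ballBound D i) :=
          Nat.mul_le_mul_right _ (hD u)
      _ = 2 * D * ballBound D i := by ring

/-- A vertex lies in the balls of few vertices. -/
lemma exists_centers {D : ℕ} {L : List (ℕ × ℕ)} (hD : ∀ u, (inc L u).length ≤ D) (i v : ℕ) :
    ∃ B : Finset ℕ, B.card ≤ ballBound D i ∧ ∀ u, v ∈ ball L i u → u ∈ B := by
  classical
  induction i with
  | zero => exact ⟨{v}, by simp [ballBound], fun u hu => by simpa [ball, eq_comm] using hu⟩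
  | succ i ih =>
    obtain ⟨B, hB, hmem⟩ := ih
    refine ⟨insert v (B.biUnion fun w => ((inc L w).flatMap fun e => [e.1, e.2]).toFinset),
      ?_, ?_⟩
    · refine (Finset.card_insert_le _ _).trans ?_
      rw [ballBound, Nat.add_comm]
      refine Nat.add_le_add_left ((Finset.card_biUnion_le_card_mul _ _ (2 * D) ?_).trans ?_) 1
      · intro w _
        refine (List.toFinset_card_le _).trans ?_
        rw [List.length_flatMap]
        simp only [List.length_cons, List.length_nil, List.map_const', List.sum_replicate,
          smul_eq_mul]
        have := hD w
        omega
      · rw [Nat.mul_comm]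
        exact Nat.mul_le_mul_left _ hB
    · intro u hu
      rw [ball, List.mem_cons, List.mem_flatMap] at hu
      rw [Finset.mem_insert, Finset.mem_biUnion]
      rcases hu with rfl | ⟨e, he, hv⟩
      · exact Or.inl rfl
      · refine Or.inr ?_
        have hu' := mem_inc.1 he
        have hue : u ∈ [e.1, e.2] := by
          rcases hu'.2 with h | h <;> simp [h]
        rw [List.mem_append] at hv
        rcases hv with hv | hv
        · refine ⟨e.1, hmem _ hv, ?_⟩
          rw [List.mem_toFinset, List.mem_flatMap]
          exact ⟨e, mem_inc.2 ⟨hu'.1, Or.inl rfl⟩, hue⟩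
        · refine ⟨e.2, hmem _ hv, ?_⟩
          rw [List.mem_toFinset, List.mem_flatMap]
          exact ⟨e, mem_inc.2 ⟨hu'.1, Or.inr rfl⟩, hue⟩

lemma mem_ball_lt {n : ℕ} {L : List (ℕ × ℕ)} (hL : ∀ e ∈ L, e.1 < n ∧ e.2 < n) (i u : ℕ)
    (hu : u < n) : ∀ w ∈ ball L i u, w < n := by
  induction i generalizing u with
  | zero => simp [ball, hu]
  | succ i ih =>
    intro w hw
    rw [ball, List.mem_cons, List.mem_flatMap] at hw
    rcases hw with rfl | ⟨e, he, hw⟩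
    · exact hu
    · have h := hL e (mem_inc.1 he).1
      rw [List.mem_append] at hw
      exact hw.elim (fun hw => ih _ h.1 w hw) (fun hw => ih _ h.2 w hw)

lemma length_inc_natEdges_le {n D : ℕ} {G : DiMultigraph (Fin n)} {σ : List (Fin n × Fin n)}
    (hσ : G.IsOrdering σ) (hD : G.IsBounded D) (u : ℕ) : (inc (natEdges σ) u).length ≤ D := by
  by_cases hu : u < n
  · refine le_trans ?_ (hD ⟨u, hu⟩)
    unfold DiMultigraph.degree
    rw [← hσ]
    clear hσ
    induction σ with
    | nil => simp [natEdges, inc]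
    | cons e σ ih =>
      have hc : ∀ p : Fin n × Fin n,
          Multiset.count p ((e :: σ : List (Fin n × Fin n)) : Multiset (Fin n × Fin n)) =
            Multiset.count p (σ : Multiset (Fin n × Fin n)) + if e = p then 1 else 0 := by
        intro p
        rw [← Multiset.cons_coe, Multiset.count_cons]
        simp only [eq_comm]
      have h2 : ∑ v : Fin n, (if e = (v, (⟨u, hu⟩ : Fin n)) then 1 else 0) =
          if e.2 = (⟨u, hu⟩ : Fin n) then 1 else 0 := by
        by_cases h : e.2 = (⟨u, hu⟩ : Fin n) <;> simp [Prod.ext_iff, h]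
      have h3 : ∑ v : Fin n, (if e = ((⟨u, hu⟩ : Fin n), v) then 1 else 0) =
          if e.1 = (⟨u, hu⟩ : Fin n) then 1 else 0 := by
        by_cases h : e.1 = (⟨u, hu⟩ : Fin n) <;> simp [Prod.ext_iff, h]
      simp only [inc, natEdges, List.map_cons, List.filter_cons] at ih ⊢
      simp only [hc, Finset.sum_add_distrib, h2, h3] at ih ⊢
      simp only [Fin.ext_iff]
      by_cases a : (e.1 : ℕ) = u <;> by_cases b : (e.2 : ℕ) = u <;>
        simp only [a, b, or_self, or_true, true_or, decide_true, decide_false, if_true, if_false,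
          Bool.false_eq_true, List.length_cons] <;> omega
  · have : inc (natEdges σ) u = [] := by
      rw [List.eq_nil_iff_forall_not_mem]
      intro e he
      have h1 := mem_inc.1 he
      have h2 := natEdges_lt σ e h1.1
      omega
    simp [this]

lemma length_le_sum_inc (n : ℕ) (L : List (ℕ × ℕ)) (hL : ∀ e ∈ L, e.1 < n ∧ e.2 < n) :
    L.length ≤ ∑ v ∈ Finset.range n, (inc L v).length := by
  induction L with
  | nil => simp
  | cons e L ih =>
    have h1 := ih fun f hf => hL f (List.mem_cons_of_mem _ hf)
    have h2 := hL e List.mem_cons_self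
    have h3 : ∑ v ∈ Finset.range n, ((inc L v).length + if e.1 = v then 1 else 0) ≤
        ∑ v ∈ Finset.range n, (inc (e :: L) v).length := by
      refine Finset.sum_le_sum fun v _ => ?_
      unfold inc
      rw [List.filter_cons]
      by_cases a : e.1 = v
      · simp [a]
      · by_cases b : e.2 = v <;> simp [a, b]
    rw [Finset.sum_add_distrib] at h3
    simp only [Finset.sum_ite_eq, Finset.mem_range, h2.1, if_true] at h3
    rw [List.length_cons]
    omega

lemma length_le_mul {n D : ℕ} {L : List (ℕ × ℕ)} (hL : ∀ e ∈ L, e.1 < n ∧ e.2 < n)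
    (hD : ∀ u, (inc L u).length ≤ D) : L.length ≤ n * D := by
  refine (length_le_sum_inc n L hL).trans ((Finset.sum_le_card_nsmul _ _ D fun v _ => hD v).trans ?_)
  simp

/-! ### Sampling: first and second moments -/

section
variable {r : ℕ}

/-- The indicator function of the event that all random bits at the positions in `A` are `1`. -/
def allOnes (A : Finset (Fin r)) (ω : Fin r → Bool) : ℝ :=
  if ∀ i ∈ A, ω i = true then 1 else 0

lemma sum_allOnes (A : Finset (Fin r)) : (∑ ω, allOnes A ω) * 2 ^ A.card = (2 : ℝ) ^ r := by
  have h1 : (∑ ω, allOnes A ω) = ∑ ω : Fin r → Bool, ∏ i, (if i ∈ A then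
      (if ω i = true then (1 : ℝ) else 0) else 1) := by
    refine Finset.sum_congr rfl fun ω _ => ?_
    unfold allOnes
    split_ifs with h
    · symm
      refine Finset.prod_eq_one fun i _ => ?_
      by_cases hi : i ∈ A <;> simp [hi, h]
    · push Not at h
      obtain ⟨i, hi, hw⟩ := h
      symm
      refine Finset.prod_eq_zero (Finset.mem_univ i) ?_
      simp [hi, hw]
  have h2 := Finset.prod_univ_sum (fun _ : Fin r => (Finset.univ : Finset Bool))
    (fun i b => if i ∈ A then (if b = true then (1 : ℝ) else 0) else 1)
  rw [Fintype.piFinset_univ] at h2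
  rw [h1, ← h2]
  have h3 : ∀ i : Fin r, (∑ b : Bool, if i ∈ A then (if b = true then (1 : ℝ) else 0) else 1) =
      if i ∈ A then 1 else 2 := by
    intro i
    by_cases hi : i ∈ A <;> simp [hi]
  simp only [h3]
  have h4 : (2 : ℝ) ^ A.card = ∏ i : Fin r, if i ∈ A then 2 else 1 := by
    rw [Finset.prod_ite_mem, Finset.univ_inter, Finset.prod_const]
  rw [h4, ← Finset.prod_mul_distrib]
  calc ∏ i : Fin r, ((if i ∈ A then (1 : ℝ) else 2) * if i ∈ A then 2 else 1)
      = ∏ _i : Fin r, (2 : ℝ) := Finset.prod_congr rfl fun i _ => by split_ifs <;> norm_num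
    _ = 2 ^ r := by simp

lemma allOnes_mul (A B : Finset (Fin r)) (ω : Fin r → Bool) :
    allOnes A ω * allOnes B ω = allOnes (A ∪ B) ω := by
  unfold allOnes
  have h : (∀ i ∈ A ∪ B, ω i = true) ↔ (∀ i ∈ A, ω i = true) ∧ ∀ i ∈ B, ω i = true := by
    simp only [Finset.mem_union, or_imp, forall_and]
  simp only [h, ite_and]
  split_ifs <;> norm_num

lemma sum_centered_mul (A B : Finset (Fin r)) :
    ∑ ω, (allOnes A ω * 2 ^ A.card - 1) * (allOnes B ω * 2 ^ B.card - 1) =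
      2 ^ r * ((2 : ℝ) ^ (A ∩ B).card - 1) := by
  have h : ∀ ω, (allOnes A ω * 2 ^ A.card - 1) * (allOnes B ω * 2 ^ B.card - 1) =
      allOnes (A ∪ B) ω * 2 ^ (A ∪ B).card * 2 ^ (A ∩ B).card - allOnes A ω * 2 ^ A.card
        - allOnes B ω * 2 ^ B.card + 1 := by
    intro ω
    have e : (2 : ℝ) ^ (A ∪ B).card * 2 ^ (A ∩ B).card = 2 ^ A.card * 2 ^ B.card := by
      rw [← pow_add, ← pow_add, Finset.card_union_add_card_inter]
    rw [mul_assoc, e, ← allOnes_mul]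
    ring
  simp only [h, Finset.sum_add_distrib, Finset.sum_sub_distrib, ← Finset.sum_mul, sum_allOnes]
  simp
  ring

/-- The variance of the Horvitz–Thompson estimator, multiplied by `2 ^ r`. Only pairs whose random
bits overlap contribute. -/
lemma sum_sq_estimator_le {ι : Type*} [Fintype ι] [DecidableEq ι] (A : ι → Finset (Fin r))
    (w : ι → ℝ)
    {M : ℝ} {s p : ℕ} (hw0 : ∀ j, 0 ≤ w j) (hwM : ∀ j, w j ≤ M) (hA : ∀ j, (A j).card ≤ s)
    (hp : ∀ j, (Finset.univ.filter fun k => ¬ Disjoint (A j) (A k)).card ≤ p) :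
    ∑ ω, ((∑ j, w j * (allOnes (A j) ω * 2 ^ (A j).card)) - ∑ j, w j) ^ 2 ≤
      2 ^ r * (Fintype.card ι * p * (M ^ 2 * 2 ^ s)) := by
  have h1 : ∀ ω, ((∑ j, w j * (allOnes (A j) ω * 2 ^ (A j).card)) - ∑ j, w j) ^ 2 =
      ∑ j, ∑ k, w j * w k * ((allOnes (A j) ω * 2 ^ (A j).card - 1) *
        (allOnes (A k) ω * 2 ^ (A k).card - 1)) := by
    intro ω
    rw [← Finset.sum_sub_distrib, sq, Finset.sum_mul_sum]
    refine Finset.sum_congr rfl fun j _ => Finset.sum_congr rfl fun k _ => ?_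
    ring
  simp only [h1]
  rw [Finset.sum_comm]
  have h2 : ∀ j, ∑ ω, ∑ k, w j * w k * ((allOnes (A j) ω * 2 ^ (A j).card - 1) *
        (allOnes (A k) ω * 2 ^ (A k).card - 1)) ≤ 2 ^ r * (p * (M ^ 2 * 2 ^ s)) := by
    intro j
    rw [Finset.sum_comm]
    simp only [← Finset.mul_sum, sum_centered_mul]
    calc ∑ k, w j * w k * (2 ^ r * ((2 : ℝ) ^ (A j ∩ A k).card - 1))
        ≤ ∑ k, if ¬ Disjoint (A j) (A k) then 2 ^ r * (M ^ 2 * 2 ^ s) else 0 := by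
          refine Finset.sum_le_sum fun k _ => ?_
          by_cases h : ¬ Disjoint (A j) (A k)
          · rw [if_pos h]
            have e1 : (2 : ℝ) ^ (A j ∩ A k).card ≤ 2 ^ s := pow_le_pow_right₀ one_le_two
              ((Finset.card_le_card Finset.inter_subset_left).trans (hA j))
            have e2 : (1 : ℝ) ≤ 2 ^ (A j ∩ A k).card := one_le_pow₀ one_le_two
            have e3 : w j * w k ≤ M ^ 2 := by
              rw [sq]
              exact mul_le_mul (hwM j) (hwM k) (hw0 k) ((hw0 j).trans (hwM j))
            calc w j * w k * (2 ^ r * ((2 : ℝ) ^ (A j ∩ A k).card - 1))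
                ≤ M ^ 2 * (2 ^ r * 2 ^ s) := by
                  refine mul_le_mul e3 ?_ ?_ (sq_nonneg M)
                  · exact mul_le_mul_of_nonneg_left (by linarith) (by positivity)
                  · exact mul_nonneg (by positivity) (by linarith)
              _ = 2 ^ r * (M ^ 2 * 2 ^ s) := by ring
          · rw [if_neg h]
            rw [not_not] at h
            rw [Finset.disjoint_iff_inter_eq_empty.1 h]
            simp
      _ = ((Finset.univ.filter fun k => ¬ Disjoint (A j) (A k)).card : ℝ) *
            (2 ^ r * (M ^ 2 * 2 ^ s)) := by
          rw [← Finset.sum_filter, Finset.sum_const, nsmul_eq_mul]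
      _ ≤ p * (2 ^ r * (M ^ 2 * 2 ^ s)) := by
          refine mul_le_mul_of_nonneg_right (by exact_mod_cast hp j) (by positivity)
      _ = 2 ^ r * (p * (M ^ 2 * 2 ^ s)) := by ring
  refine (Finset.sum_le_sum fun j _ => h2 j).trans (le_of_eq ?_)
  simp
  ring

/-- Markov's inequality for the uniform distribution on a finite type. -/
lemma card_mul_le_sum {Ω : Type*} [Fintype Ω] (f : Ω → ℝ) (hf : ∀ ω, 0 ≤ f ω) (b : ℝ)
    (p : Ω → Prop) [DecidablePred p] (hp : ∀ ω, p ω → b ≤ f ω) :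
    ((Finset.univ.filter p).card : ℝ) * b ≤ ∑ ω, f ω := by
  rw [← nsmul_eq_mul]
  refine (Finset.card_nsmul_le_sum _ f b fun ω hω => hp ω (Finset.mem_filter.1 hω).2).trans ?_
  exact Finset.sum_le_sum_of_subset_of_nonneg (Finset.filter_subset _ _) fun ω _ _ => hf ω

end

open StreamingAlgorithm in
/-- An algorithm whose memory is a function of the random bits that are drawn initially succeeds
with the frequency with which these bits are good. -/
lemma randomBits_map_ge {r : ℕ} (f : List Bool → ℝ) (s : Set ℝ) (p : (Fin r → Bool) → Prop)
    [DecidablePred p] (hbad : 100 * (Finset.univ.filter p).card ≤ 2 ^ r)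
    (hf : ∀ ω, ¬ p ω → f (List.ofFn ω) ∈ s) :
    (99 / 100 : ℝ≥0∞) ≤ ((randomBits r).map f).toOuterMeasure s := by
  classical
  rw [PMF.toOuterMeasure_map_apply, randomBits, PMF.toOuterMeasure_map_apply,
    PMF.toOuterMeasure_uniformOfFintype_apply]
  have h1 : (Finset.univ.filter fun ω => ¬ p ω).card ≤
      Fintype.card (List.ofFn ⁻¹' (f ⁻¹' s) : Set (Fin r → Bool)) := by
    rw [← Set.toFinset_card]
    refine Finset.card_le_card fun ω hω => ?_
    rw [Set.mem_toFinset]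
    exact hf ω (Finset.mem_filter.1 hω).2
  have h2 : (Finset.univ.filter p).card + (Finset.univ.filter fun ω => ¬ p ω).card = 2 ^ r := by
    rw [Finset.card_filter_add_card_filter_not]
    simp
  have h3 : Fintype.card (Fin r → Bool) = 2 ^ r := by simp
  rw [h3]
  set c := Fintype.card (List.ofFn ⁻¹' (f ⁻¹' s) : Set (Fin r → Bool))
  have h4 : 99 * 2 ^ r ≤ 100 * c := by omega
  rw [ENNReal.div_le_iff (by norm_num) (by norm_num), mul_comm, ← mul_div_assoc,
    ENNReal.le_div_iff_mul_le (by simp) (by simp)]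
  exact_mod_cast h4

/-! ### The streaming algorithm -/

/-- An upper bound for the number of vertices, with repetitions, in the ball around an edge whose
radius is the number `2 * H` of rounds of the local algorithm. -/
def ballVol (D H : ℕ) : ℕ := 2 * ballBound D (2 * H)

/-- The sampling exponent: a vertex is sampled with probability `2 ^ (-expo D H n)`. It is a
constant fraction of `log n`, small enough that many balls are sampled completely. -/
def expo (D H n : ℕ) : ℕ := Nat.log 2 n / (ballVol D H + 2)

/-- The number of residue classes (buckets) of vertices: vertices in the same class are sampled
together, so that the random bits fit into sublinear memory. -/
def buckets (D H n : ℕ) : ℕ := 2 ^ (Nat.log 2 n - expo D H n)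

/-- The number of random bits: `expo D H n` of them for each bucket. -/
def seedLen (D H n : ℕ) : ℕ := buckets D H n * expo D H n

/-- The length of the binary words that hold a vertex or the number of edges. -/
def wordLen (D n : ℕ) : ℕ := Nat.log 2 n + 1 + D

/-- If the number of edges exceeds this constant times the number of buckets, then the variance of
the estimator is small enough for a failure probability of `1 / 200`. -/
def capConst (D H : ℕ) : ℕ := 400 * ballVol D H * ballBound D (2 * H) * D * H ^ 2

/-- The initial edges of the stream, up to this number, are stored unconditionally. -/
def exactCap (D H n : ℕ) : ℕ := capConst D H * buckets D H n

/-- The largest number of edges that are stored. -/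
def storeCap (D H n : ℕ) : ℕ := (capConst D H + 800 * D) * buckets D H n

/-- The positions of the random bits that decide whether all vertices in `W` are sampled: the
bucket `b` owns the positions `b * t, …, b * t + t - 1`. -/
def positions (t R : ℕ) (W : List ℕ) : List ℕ :=
  (List.range (R * t)).filter fun i => W.any fun w => w % R == i / t

/-- All vertices in `W` are sampled. -/
def sampled (t R : ℕ) (ω : List Bool) (W : List ℕ) : Bool :=
  (positions t R W).all fun i => ω.getD i false

/-- The contribution of an edge to the Horvitz–Thompson estimator: its weight divided by the
probability that its ball is sampled, if this happens, and `0` otherwise. -/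
def estimateAt (P t R : ℕ) (ω : List Bool) (L : List (ℕ × ℕ)) (e : ℕ × ℕ) : ℕ :=
  bif sampled t R ω (edgeBall P L e) then
    2 ^ (positions t R (edgeBall P L e)).length * edgeWeight P L e else 0

/-- The Horvitz–Thompson estimator for the cut value of the local algorithm. -/
def estimate (P t R : ℕ) (ω : List Bool) (L : List (ℕ × ℕ)) : ℕ :=
  (L.map (estimateAt P t R ω L)).sum

/-- The binary word of length `W` that represents `k < 2 ^ W`, least significant bit first. -/
def toWord (W k : ℕ) : List Bool := (List.range W).map fun i => k / 2 ^ i % 2 == 1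

/-- The number that is represented by a binary word. -/
def ofWord (l : List Bool) : ℕ := l.foldr (fun b k => (bif b then 1 else 0) + 2 * k) 0

/-- The binary word that represents an edge. -/
def edgeWord (W : ℕ) (e : ℕ × ℕ) : List Bool := toWord W e.1 ++ toWord W e.2

/-- The word of length `W` at position `s` of the memory `q`. -/
def readWord (q : List Bool) (s W : ℕ) : ℕ := ofWord ((q.drop s).take W)

/-- The edges that are represented by the memory `q` from position `s` on. -/
def readEdges (q : List Bool) (s W : ℕ) : List (ℕ × ℕ) :=
  (List.range ((q.length - s) / (2 * W))).map fun j =>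
    (readWord q (s + 2 * W * j) W, readWord q (s + 2 * W * j + W) W)

/-- Whether the edge `e` is to be stored, given the memory `q`. -/
def keeps (D H n : ℕ) (q : List Bool) (e : ℕ × ℕ) : Bool :=
  (Nat.ble (readWord q (seedLen D H n) (wordLen D n) + 1) (exactCap D H n) ||
    (sampled (expo D H n) (buckets D H n) (q.take (seedLen D H n)) [e.1] ||
      sampled (expo D H n) (buckets D H n) (q.take (seedLen D H n)) [e.2])) &&
  Nat.ble (q.length + 1)
    (seedLen D H n + wordLen D n + 2 * wordLen D n * storeCap D H n)

/-- The memory consists of the random bits, the number of edges read so far, and the stored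
edges. -/
def updateMem (D H n : ℕ) (q : List Bool) (e : ℕ × ℕ) : List Bool :=
  q.take (seedLen D H n) ++
    (toWord (wordLen D n) (readWord q (seedLen D H n) (wordLen D n) + 1) ++
      (q.drop (seedLen D H n + wordLen D n) ++
        bif keeps D H n q e then edgeWord (wordLen D n) e else []))

/-- The estimate of the scaled cut value. If the stream is short enough to be stored completely,
it is exact: the sampling exponent `0` means that everything is sampled. -/
def finalEstimate (D H n : ℕ) (q : List Bool) : ℕ :=
  bif Nat.ble (readWord q (seedLen D H n) (wordLen D n)) (exactCap D H n) then
    estimate (2 * H) 0 (buckets D H n) [] (readEdges q (seedLen D H n + wordLen D n) (wordLen D n))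
  else
    estimate (2 * H) (expo D H n) (buckets D H n) (q.take (seedLen D H n))
      (readEdges q (seedLen D H n + wordLen D n) (wordLen D n))

/-- The answer, as a numerator and a denominator minus one. -/
def outputOf (D H n : ℕ) (q : List Bool) : ℕ × ℕ :=
  (H * finalEstimate D H n q - (2 * H) ^ 4 * readWord q (seedLen D H n) (wordLen D n),
    H * (2 * H) ^ 4 * readWord q (seedLen D H n) (wordLen D n) - 1)

/-! ### Computability -/

section Computability

attribute [local fun_prop] Primrec Primrec.id Primrec.const Primrec.comp

variable {α β γ : Type*} [Primcodable α] [Primcodable β] [Primcodable γ]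

@[local fun_prop]
lemma primrec_fst {f : α → β × γ} (hf : Primrec f) : Primrec fun a => (f a).1 :=
  Primrec.fst.comp hf

@[local fun_prop]
lemma primrec_snd {f : α → β × γ} (hf : Primrec f) : Primrec fun a => (f a).2 :=
  Primrec.snd.comp hf

@[local fun_prop]
lemma primrec_mk {f : α → β} {g : α → γ} (hf : Primrec f) (hg : Primrec g) :
    Primrec fun a => (f a, g a) :=
  hf.pair hg

@[local fun_prop]
lemma primrec_add {f g : α → ℕ} (hf : Primrec f) (hg : Primrec g) :
    Primrec fun a => f a + g a :=
  Primrec.nat_add.comp hf hg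

@[local fun_prop]
lemma primrec_sub {f g : α → ℕ} (hf : Primrec f) (hg : Primrec g) :
    Primrec fun a => f a - g a :=
  Primrec.nat_sub.comp hf hg

@[local fun_prop]
lemma primrec_mul {f g : α → ℕ} (hf : Primrec f) (hg : Primrec g) :
    Primrec fun a => f a * g a :=
  Primrec.nat_mul.comp hf hg

@[local fun_prop]
lemma primrec_div {f g : α → ℕ} (hf : Primrec f) (hg : Primrec g) :
    Primrec fun a => f a / g a :=
  Primrec.nat_div.comp hf hg

@[local fun_prop]
lemma primrec_mod {f g : α → ℕ} (hf : Primrec f) (hg : Primrec g) :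
    Primrec fun a => f a % g a :=
  Primrec.nat_mod.comp hf hg

@[local fun_prop]
lemma primrec_pow {f g : α → ℕ} (hf : Primrec f) (hg : Primrec g) :
    Primrec fun a => f a ^ g a := by
  have h : Primrec₂ fun (a : α) (p : ℕ × ℕ) => p.2 * f a :=
    show Primrec fun x : α × ℕ × ℕ => x.2.2 * f x.1 by fun_prop
  refine (Primrec.nat_rec' hg (Primrec.const 1) h).of_eq fun a => ?_
  induction g a with
  | zero => rfl
  | succ k ih => rw [pow_succ, ← ih]

@[local fun_prop]
lemma primrec_ble {f g : α → ℕ} (hf : Primrec f) (hg : Primrec g) :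
    Primrec fun a => Nat.ble (f a) (g a) := by
  refine (PrimrecPred.decide (Primrec.nat_le.comp hf hg)).of_eq fun a => ?_
  rw [Bool.eq_iff_iff, decide_eq_true_iff, Nat.ble_eq]

@[local fun_prop]
lemma primrec_beq {f g : α → ℕ} (hf : Primrec f) (hg : Primrec g) :
    Primrec fun a => f a == g a :=
  (PrimrecPred.decide (Primrec.eq.comp hf hg)).of_eq fun _ => rfl

@[local fun_prop]
lemma primrec_or {f g : α → Bool} (hf : Primrec f) (hg : Primrec g) :
    Primrec fun a => f a || g a :=
  Primrec.or.comp hf hg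

@[local fun_prop]
lemma primrec_and {f g : α → Bool} (hf : Primrec f) (hg : Primrec g) :
    Primrec fun a => f a && g a :=
  Primrec.and.comp hf hg

@[local fun_prop]
lemma primrec_cond {c : α → Bool} {f g : α → β} (hc : Primrec c) (hf : Primrec f)
    (hg : Primrec g) : Primrec fun a => cond (c a) (f a) (g a) :=
  Primrec.cond hc hf hg

@[local fun_prop]
lemma primrec_cons {f : α → β} {g : α → List β} (hf : Primrec f) (hg : Primrec g) :
    Primrec fun a => f a :: g a :=
  Primrec.list_cons.comp hf hg

@[local fun_prop]
lemma primrec_append {f g : α → List β} (hf : Primrec f) (hg : Primrec g) :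
    Primrec fun a => f a ++ g a :=
  Primrec.list_append.comp hf hg

@[local fun_prop]
lemma primrec_length {f : α → List β} (hf : Primrec f) : Primrec fun a => (f a).length :=
  Primrec.list_length.comp hf

@[local fun_prop]
lemma primrec_take {f : α → ℕ} {g : α → List β} (hf : Primrec f) (hg : Primrec g) :
    Primrec fun a => (g a).take (f a) :=
  Primrec.list_take.comp hf hg

@[local fun_prop]
lemma primrec_drop {f : α → ℕ} {g : α → List β} (hf : Primrec f) (hg : Primrec g) :
    Primrec fun a => (g a).drop (f a) :=
  Primrec.list_drop.comp hf hg

@[local fun_prop]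
lemma primrec_range {f : α → ℕ} (hf : Primrec f) : Primrec fun a => List.range (f a) :=
  Primrec.list_range.comp hf

@[local fun_prop]
lemma primrec_map {f : α → List β} {g : α → β → γ} (hf : Primrec f)
    (hg : Primrec fun p : α × β => g p.1 p.2) : Primrec fun a => (f a).map (g a) :=
  Primrec.list_map hf hg

@[local fun_prop]
lemma primrec_flatMap {f : α → List β} {g : α → β → List γ} (hf : Primrec f)
    (hg : Primrec fun p : α × β => g p.1 p.2) : Primrec fun a => (f a).flatMap (g a) :=
  Primrec.list_flatMap hf hg

@[local fun_prop]
lemma primrec_foldr {f : α → List β} {g : α → γ} {h : α → β → γ → γ} (hf : Primrec f)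
    (hg : Primrec g) (hh : Primrec fun p : α × β × γ => h p.1 p.2.1 p.2.2) :
    Primrec fun a => (f a).foldr (h a) (g a) :=
  Primrec.list_foldr (h := fun a p => h a p.1 p.2) hf hg hh

@[local fun_prop]
lemma primrec_sum {f : α → List ℕ} (hf : Primrec f) : Primrec fun a => (f a).sum := by
  have h : Primrec fun a => (f a).foldr (fun x y => x + y) 0 := by fun_prop
  exact h.of_eq fun a => rfl

@[local fun_prop]
lemma primrec_any {f : α → List β} {g : α → β → Bool} (hf : Primrec f)
    (hg : Primrec fun p : α × β => g p.1 p.2) : Primrec fun a => (f a).any (g a) := by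
  have h : Primrec fun a => (f a).foldr (fun x y => g a x || y) false :=
    primrec_foldr hf (Primrec.const _) (primrec_or (hg.comp (f := fun p : α × β => g p.1 p.2)
      (g := fun p : α × β × Bool => (p.1, p.2.1)) (by fun_prop)) (by fun_prop))
  refine h.of_eq fun a => ?_
  induction f a with
  | nil => rfl
  | cons b l ih => rw [List.foldr_cons, List.any_cons, ih]

@[local fun_prop]
lemma primrec_all {f : α → List β} {g : α → β → Bool} (hf : Primrec f)
    (hg : Primrec fun p : α × β => g p.1 p.2) : Primrec fun a => (f a).all (g a) := by
  have h : Primrec fun a => (f a).foldr (fun x y => g a x && y) true :=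
    primrec_foldr hf (Primrec.const _) (primrec_and (hg.comp (f := fun p : α × β => g p.1 p.2)
      (g := fun p : α × β × Bool => (p.1, p.2.1)) (by fun_prop)) (by fun_prop))
  refine h.of_eq fun a => ?_
  induction f a with
  | nil => rfl
  | cons b l ih => rw [List.foldr_cons, List.all_cons, ih]

@[local fun_prop]
lemma primrec_filter {f : α → List β} {g : α → β → Bool} (hf : Primrec f)
    (hg : Primrec fun p : α × β => g p.1 p.2) : Primrec fun a => (f a).filter (g a) := by
  have h : Primrec fun a => (f a).flatMap fun b => cond (g a b) [b] [] :=
    primrec_flatMap hf (primrec_cond hg (by fun_prop) (by fun_prop))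
  refine h.of_eq fun a => ?_
  induction f a with
  | nil => rfl
  | cons b l ih =>
    rw [List.flatMap_cons, List.filter_cons, ih]
    cases g a b <;> rfl

@[local fun_prop]
lemma primrec_getD {f : α → List β} {g : α → ℕ} (d : β) (hf : Primrec f) (hg : Primrec g) :
    Primrec fun a => (f a).getD (g a) d :=
  (Primrec.list_getD d).comp hf hg

@[local fun_prop]
lemma primrec_log {f : α → ℕ} (hf : Primrec f) : Primrec fun a => Nat.log 2 (f a) := by
  have h : Primrec fun a => Nat.findGreatest (fun k => 2 ^ k ≤ f a) (f a) := by
    refine Primrec.nat_findGreatest hf ?_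
    exact PrimrecRel.comp (f := fun p : α × ℕ => 2 ^ p.2) (g := fun p : α × ℕ => f p.1)
      Primrec.nat_le (by fun_prop) (by fun_prop)
  refine h.of_eq fun a => ?_
  rcases Nat.eq_zero_or_pos (f a) with h0 | h0
  · simp [h0]
  · rw [Nat.findGreatest_eq_iff]
    refine ⟨(Nat.log_le_self 2 _), fun _ => Nat.pow_log_le_self 2 h0.ne', fun k hk _ hle => ?_⟩
    exact absurd (Nat.le_log_of_pow_le one_lt_two hle) (by omega)

@[local fun_prop]
lemma primrec_inc {f : α → List (ℕ × ℕ)} {g : α → ℕ} (hf : Primrec f) (hg : Primrec g) :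
    Primrec fun a => inc (f a) (g a) := by
  have h : Primrec fun a => (f a).filter fun e => (e.1 == g a) || (e.2 == g a) := by fun_prop
  refine h.of_eq fun a => ?_
  rw [inc]
  congr 1
  funext e
  simp only [Bool.decide_or]
  rfl

lemma primrec_outSlack (Q : ℕ) {x : α → ℕ → ℕ} (hx : Primrec fun p : α × ℕ => x p.1 p.2)
    {f : α → List (ℕ × ℕ)} {g : α → ℕ} (hf : Primrec f) (hg : Primrec g) :
    Primrec fun a => outSlack Q (f a) (x a) (g a) := by
  have h : Primrec fun a => ((inc (f a) (g a)).map fun e =>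
      bif e.1 == g a then Q - x a e.2 else 0).sum := by
    have hx' : Primrec fun p : α × ℕ × ℕ => x p.1 p.2.2 :=
      hx.comp (f := fun p : α × ℕ => x p.1 p.2) (g := fun p : α × ℕ × ℕ => (p.1, p.2.2))
        (by fun_prop)
    fun_prop
  refine h.of_eq fun a => ?_
  rw [outSlack]
  congr 2
  funext e
  by_cases h : e.1 = g a
  · simp [h]
  · simp [h, beq_eq_false_iff_ne.2 h]

lemma primrec_inLoad {x : α → ℕ → ℕ} (hx : Primrec fun p : α × ℕ => x p.1 p.2)
    {f : α → List (ℕ × ℕ)} {g : α → ℕ} (hf : Primrec f) (hg : Primrec g) :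
    Primrec fun a => inLoad (f a) (x a) (g a) := by
  have h : Primrec fun a => ((inc (f a) (g a)).map fun e =>
      bif e.2 == g a then x a e.1 else 0).sum := by
    have hx' : Primrec fun p : α × ℕ × ℕ => x p.1 p.2.1 :=
      hx.comp (f := fun p : α × ℕ => x p.1 p.2) (g := fun p : α × ℕ × ℕ => (p.1, p.2.1))
        (by fun_prop)
    fun_prop
  refine h.of_eq fun a => ?_
  rw [inLoad]
  congr 2
  funext e
  by_cases h : e.2 = g a
  · simp [h]
  · simp [h, beq_eq_false_iff_ne.2 h]

/-- Each round is primitive recursive; since the number of rounds is a constant of the algorithm,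
induction on it suffices. -/
lemma primrec_traj (P i : ℕ) : Primrec fun p : List (ℕ × ℕ) × ℕ => traj P p.1 i p.2 := by
  induction i with
  | zero => exact Primrec.const 0
  | succ i ih =>
    have h1 : Primrec fun p : (List (ℕ × ℕ) × ℕ) × ℕ => traj P p.1.1 i p.2 :=
      ih.comp (f := fun p : List (ℕ × ℕ) × ℕ => traj P p.1 i p.2)
        (g := fun p : (List (ℕ × ℕ) × ℕ) × ℕ => (p.1.1, p.2)) (by fun_prop)
    have h2 : Primrec fun p : (List (ℕ × ℕ) × ℕ) × ℕ => traj P p.1.1 i p.2 + (P - i) * P := by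
      fun_prop
    have a1 := primrec_outSlack (P ^ 2) (x := fun (p : List (ℕ × ℕ) × ℕ) v => traj P p.1 i v) h1
      (Primrec.fst) (Primrec.snd)
    have a2 := primrec_inLoad (x := fun (p : List (ℕ × ℕ) × ℕ) v => traj P p.1 i v) h1
      (Primrec.fst) (Primrec.snd)
    have b1 := primrec_outSlack (P ^ 2)
      (x := fun (p : List (ℕ × ℕ) × ℕ) v => traj P p.1 i v + (P - i) * P) h2
      (Primrec.fst) (Primrec.snd)
    have b2 := primrec_inLoad
      (x := fun (p : List (ℕ × ℕ) × ℕ) v => traj P p.1 i v + (P - i) * P) h2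
      (Primrec.fst) (Primrec.snd)
    have h : Primrec fun p : List (ℕ × ℕ) × ℕ => traj P p.1 i p.2 +
        P * (outSlack (P ^ 2) p.1 (fun v => traj P p.1 i v) p.2
            - inLoad p.1 (fun v => traj P p.1 i v) p.2) /
          ((outSlack (P ^ 2) p.1 (fun v => traj P p.1 i v) p.2
            - inLoad p.1 (fun v => traj P p.1 i v) p.2) +
          (inLoad p.1 (fun v => traj P p.1 i v + (P - i) * P) p.2
            - outSlack (P ^ 2) p.1 (fun v => traj P p.1 i v + (P - i) * P) p.2)) := by
      fun_prop
    exact h.of_eq fun p => rfl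

lemma primrec_ball (i : ℕ) : Primrec fun p : List (ℕ × ℕ) × ℕ => ball p.1 i p.2 := by
  induction i with
  | zero =>
    have h : Primrec fun p : List (ℕ × ℕ) × ℕ => [p.2] := by fun_prop
    exact h
  | succ i ih =>
    have h1 : Primrec fun p : (List (ℕ × ℕ) × ℕ) × ℕ × ℕ => ball p.1.1 i p.2.1 :=
      ih.comp (f := fun p : List (ℕ × ℕ) × ℕ => ball p.1 i p.2)
        (g := fun p : (List (ℕ × ℕ) × ℕ) × ℕ × ℕ => (p.1.1, p.2.1)) (by fun_prop)
    have h2 : Primrec fun p : (List (ℕ × ℕ) × ℕ) × ℕ × ℕ => ball p.1.1 i p.2.2 :=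
      ih.comp (f := fun p : List (ℕ × ℕ) × ℕ => ball p.1 i p.2)
        (g := fun p : (List (ℕ × ℕ) × ℕ) × ℕ × ℕ => (p.1.1, p.2.2)) (by fun_prop)
    have h : Primrec fun p : List (ℕ × ℕ) × ℕ =>
        p.2 :: (inc p.1 p.2).flatMap fun e => ball p.1 i e.1 ++ ball p.1 i e.2 := by
      fun_prop
    exact h

@[local fun_prop]
lemma primrec_edgeBall (i : ℕ) {f : α → List (ℕ × ℕ)} {g : α → ℕ × ℕ} (hf : Primrec f)
    (hg : Primrec g) : Primrec fun a => edgeBall i (f a) (g a) := by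
  have h1 : Primrec fun a => ball (f a) i (g a).1 :=
    (primrec_ball i).comp (g := fun a => (f a, (g a).1)) (by fun_prop)
  have h2 : Primrec fun a => ball (f a) i (g a).2 :=
    (primrec_ball i).comp (g := fun a => (f a, (g a).2)) (by fun_prop)
  exact primrec_append h1 h2

@[local fun_prop]
lemma primrec_edgeWeight (P : ℕ) {f : α → List (ℕ × ℕ)} {g : α → ℕ × ℕ} (hf : Primrec f)
    (hg : Primrec g) : Primrec fun a => edgeWeight P (f a) (g a) := by
  have h1 : Primrec fun a => traj P (f a) P (g a).1 :=
    (primrec_traj P P).comp (g := fun a => (f a, (g a).1)) (by fun_prop)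
  have h2 : Primrec fun a => traj P (f a) P (g a).2 :=
    (primrec_traj P P).comp (g := fun a => (f a, (g a).2)) (by fun_prop)
  unfold edgeWeight
  fun_prop

@[local fun_prop]
lemma primrec_positions {t R : α → ℕ} {W : α → List ℕ} (ht : Primrec t) (hR : Primrec R)
    (hW : Primrec W) : Primrec fun a => positions (t a) (R a) (W a) := by
  unfold positions
  fun_prop

@[local fun_prop]
lemma primrec_sampled {t R : α → ℕ} {ω : α → List Bool} {W : α → List ℕ} (ht : Primrec t)
    (hR : Primrec R) (hω : Primrec ω) (hW : Primrec W) :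
    Primrec fun a => sampled (t a) (R a) (ω a) (W a) := by
  unfold sampled
  fun_prop

@[local fun_prop]
lemma primrec_estimate (P : ℕ) {t R : α → ℕ} {ω : α → List Bool} {L : α → List (ℕ × ℕ)}
    (ht : Primrec t) (hR : Primrec R) (hω : Primrec ω) (hL : Primrec L) :
    Primrec fun a => estimate P (t a) (R a) (ω a) (L a) := by
  unfold estimate estimateAt
  fun_prop

@[local fun_prop]
lemma primrec_toWord {f g : α → ℕ} (hf : Primrec f) (hg : Primrec g) :
    Primrec fun a => toWord (f a) (g a) := by
  unfold toWord
  fun_prop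

@[local fun_prop]
lemma primrec_readWord {q : α → List Bool} {s W : α → ℕ} (hq : Primrec q) (hs : Primrec s)
    (hW : Primrec W) : Primrec fun a => readWord (q a) (s a) (W a) := by
  unfold readWord ofWord
  fun_prop

@[local fun_prop]
lemma primrec_readEdges {q : α → List Bool} {s W : α → ℕ} (hq : Primrec q) (hs : Primrec s)
    (hW : Primrec W) : Primrec fun a => readEdges (q a) (s a) (W a) := by
  unfold readEdges
  fun_prop

@[local fun_prop]
lemma primrec_expo (D H : ℕ) {f : α → ℕ} (hf : Primrec f) : Primrec fun a => expo D H (f a) := by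
  unfold expo
  fun_prop

@[local fun_prop]
lemma primrec_buckets (D H : ℕ) {f : α → ℕ} (hf : Primrec f) :
    Primrec fun a => buckets D H (f a) := by
  unfold buckets
  fun_prop

@[local fun_prop]
lemma primrec_seedLen (D H : ℕ) {f : α → ℕ} (hf : Primrec f) :
    Primrec fun a => seedLen D H (f a) := by
  unfold seedLen
  fun_prop

@[local fun_prop]
lemma primrec_wordLen (D : ℕ) {f : α → ℕ} (hf : Primrec f) :
    Primrec fun a => wordLen D (f a) := by
  unfold wordLen
  fun_prop

lemma primrec_updateMem (D H : ℕ) : Primrec fun p : (ℕ × List Bool) × ((ℕ × ℕ) × List Bool) =>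
    updateMem D H p.1.1 p.1.2 p.2.1 := by
  unfold updateMem keeps edgeWord exactCap storeCap
  fun_prop

lemma primrec_outputOf (D H : ℕ) : Primrec fun p : ℕ × (List Bool × List Bool) =>
    outputOf D H p.1 p.2.1 := by
  unfold outputOf finalEstimate exactCap
  fun_prop

/-- The streaming algorithm for graphs of maximum degree at most `D`. It runs `2 * H` rounds of the
local algorithm and loses `O(1 / H)` in the approximation ratio.
Random bits are used only for the initial memory. -/
def algorithm (D H : ℕ) : StreamingAlgorithm where
  coins := seedLen D H
  init n ω := ω ++ toWord (wordLen D n) 0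
  update n q e _ := updateMem D H n q e
  output n q _ := outputOf D H n q
  computable_coins := (primrec_seedLen D H Primrec.id).to_comp
  computable_init := Primrec.to_comp (by fun_prop)
  computable_update := (primrec_updateMem D H).to_comp
  computable_output := (primrec_outputOf D H).to_comp

end Computability

/-! ### The contents of the memory -/

lemma length_toWord (W k : ℕ) : (toWord W k).length = W := by simp [toWord]

lemma length_edgeWord (W : ℕ) (e : ℕ × ℕ) : (edgeWord W e).length = 2 * W := by
  rw [edgeWord, List.length_append, length_toWord, length_toWord, two_mul]

lemma ofWord_toWord (W k : ℕ) (hk : k < 2 ^ W) : ofWord (toWord W k) = k := by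
  induction W generalizing k with
  | zero =>
    have : k = 0 := by simpa using hk
    subst this
    rfl
  | succ W ih =>
    have h1 : toWord (W + 1) k = (k % 2 == 1) :: toWord W (k / 2) := by
      simp only [toWord, List.range_succ_eq_map, List.map_cons, List.map_map, pow_zero,
        Nat.div_one]
      congr 1
      refine List.map_congr_left fun i _ => ?_
      simp only [Function.comp_apply, Nat.succ_eq_add_one, pow_succ', Nat.div_div_eq_div_mul]
    have h2 := ih (k / 2) (by rw [pow_succ] at hk; omega)
    rw [h1]
    unfold ofWord at h2 ⊢
    rw [List.foldr_cons, h2]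
    rcases Nat.mod_two_eq_zero_or_one k with h | h
    · simp only [h]
      simp
      omega
    · simp only [h]
      simp
      omega

/-- The memory that consists of the random bits `ω`, the number `m` and the edges `L`. -/
def mem (W : ℕ) (ω : List Bool) (m : ℕ) (L : List (ℕ × ℕ)) : List Bool :=
  ω ++ (toWord W m ++ L.flatMap (edgeWord W))

lemma length_flatMap_edgeWord (W : ℕ) (L : List (ℕ × ℕ)) :
    (L.flatMap (edgeWord W)).length = 2 * W * L.length := by
  induction L with
  | nil => simp
  | cons e L ih =>
    rw [List.flatMap_cons, List.length_append, ih, length_edgeWord, List.length_cons]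
    ring

lemma length_mem (W : ℕ) (ω : List Bool) (m : ℕ) (L : List (ℕ × ℕ)) :
    (mem W ω m L).length = ω.length + W + 2 * W * L.length := by
  rw [mem, List.length_append, List.length_append, length_toWord, length_flatMap_edgeWord,
    Nat.add_assoc]

lemma readWord_append (W k : ℕ) (hk : k < 2 ^ W) (l l' : List Bool) (s : ℕ) (hs : l.length = s) :
    readWord (l ++ (toWord W k ++ l')) s W = k := by
  rw [readWord, ← hs, List.drop_left, List.take_left' (length_toWord W k), ofWord_toWord W k hk]

lemma readWord_mem (W m : ℕ) (hm : m < 2 ^ W) (ω : List Bool) (L : List (ℕ × ℕ)) :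
    readWord (mem W ω m L) ω.length W = m :=
  readWord_append W m hm _ _ _ rfl

lemma readEdges_append (W : ℕ) (hW : 0 < W) (L : List (ℕ × ℕ))
    (hL : ∀ e ∈ L, e.1 < 2 ^ W ∧ e.2 < 2 ^ W) (l : List Bool) :
    readEdges (l ++ L.flatMap (edgeWord W)) l.length W = L := by
  induction L generalizing l with
  | nil => simp [readEdges]
  | cons e L ih =>
    have h1 := ih (fun f hf => hL f (List.mem_cons_of_mem _ hf)) (l ++ edgeWord W e)
    have h2 := hL e List.mem_cons_self
    have e1 : l ++ edgeWord W e ++ L.flatMap (edgeWord W) =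
        l ++ (e :: L).flatMap (edgeWord W) := by
      rw [List.flatMap_cons, List.append_assoc]
    rw [e1] at h1
    have hlen : (l ++ (e :: L).flatMap (edgeWord W)).length - l.length =
        2 * W * (L.length + 1) := by
      rw [List.length_append, length_flatMap_edgeWord, List.length_cons, Nat.add_sub_cancel_left]
    have hlen' : (l ++ (e :: L).flatMap (edgeWord W)).length - (l ++ edgeWord W e).length =
        2 * W * L.length := by
      rw [List.length_append, List.length_append, length_flatMap_edgeWord, List.length_cons,
        length_edgeWord, Nat.add_sub_add_left, Nat.mul_succ, Nat.add_sub_cancel]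
    unfold readEdges at h1 ⊢
    rw [hlen', Nat.mul_div_cancel_left _ (by omega)] at h1
    rw [hlen, Nat.mul_div_cancel_left _ (by omega), List.range_succ_eq_map, List.map_cons,
      List.map_map]
    congr 1
    · refine Prod.ext ?_ ?_
      · dsimp only
        rw [List.flatMap_cons, edgeWord, List.append_assoc]
        exact readWord_append W e.1 h2.1 _ _ _ (by simp)
      · dsimp only
        rw [List.flatMap_cons, edgeWord, List.append_assoc, ← List.append_assoc]
        exact readWord_append W e.2 h2.2 _ _ _ (by simp [length_toWord])
    · refine Eq.trans ?_ h1
      refine List.map_congr_left fun j _ => ?_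
      have e2 : l.length + 2 * W * (j + 1) = (l ++ edgeWord W e).length + 2 * W * j := by
        rw [List.length_append, length_edgeWord]
        ring
      simp only [Function.comp_apply, Nat.succ_eq_add_one, e2]

lemma readEdges_mem (W : ℕ) (hW : 0 < W) (ω : List Bool) (m : ℕ) (L : List (ℕ × ℕ))
    (hL : ∀ e ∈ L, e.1 < 2 ^ W ∧ e.2 < 2 ^ W) :
    readEdges (mem W ω m L) (ω.length + W) W = L := by
  have := readEdges_append W hW L hL (ω ++ toWord W m)
  rwa [List.length_append, length_toWord, List.append_assoc] at this

/-- The edge `e` has a sampled endpoint. -/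
def touches (t R : ℕ) (ω : List Bool) (e : ℕ × ℕ) : Bool :=
  sampled t R ω [e.1] || sampled t R ω [e.2]

/-- The effect of an edge on the number of edges read and on the list of stored edges. -/
def storeStep (D H n : ℕ) (ω : List Bool) (st : ℕ × List (ℕ × ℕ)) (e : ℕ × ℕ) :
    ℕ × List (ℕ × ℕ) :=
  (st.1 + 1, if (st.1 < exactCap D H n ∨ touches (expo D H n) (buckets D H n) ω e = true) ∧
    st.2.length < storeCap D H n then st.2 ++ [e] else st.2)

lemma wordLen_pos (D n : ℕ) : 0 < wordLen D n := by unfold wordLen; omega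

lemma updateMem_mem (D H n : ℕ) (ω : List Bool) (hω : ω.length = seedLen D H n)
    (st : ℕ × List (ℕ × ℕ)) (hm : st.1 < 2 ^ wordLen D n) (e : ℕ × ℕ) :
    updateMem D H n (mem (wordLen D n) ω st.1 st.2) e =
      mem (wordLen D n) ω (storeStep D H n ω st e).1 (storeStep D H n ω st e).2 := by
  obtain ⟨m, L⟩ := st
  dsimp only at hm ⊢
  have h1 : readWord (mem (wordLen D n) ω m L) (seedLen D H n) (wordLen D n) = m := by
    rw [← hω]; exact readWord_mem _ _ hm _ _
  have h2 : (mem (wordLen D n) ω m L).take (seedLen D H n) = ω := by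
    rw [← hω, mem, List.take_left]
  have h3 : (mem (wordLen D n) ω m L).drop (seedLen D H n + wordLen D n) =
      L.flatMap (edgeWord (wordLen D n)) := by
    rw [mem, ← List.append_assoc]
    exact List.drop_left' (by rw [List.length_append, length_toWord, hω])
  have h4 : keeps D H n (mem (wordLen D n) ω m L) e = true ↔
      (m < exactCap D H n ∨ touches (expo D H n) (buckets D H n) ω e = true) ∧
        L.length < storeCap D H n := by
    have hlen : (mem (wordLen D n) ω m L).length + 1 ≤
        seedLen D H n + wordLen D n + 2 * wordLen D n * storeCap D H n ↔
        L.length < storeCap D H n := by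
      rw [length_mem, hω]
      have hW := wordLen_pos D n
      constructor
      · intro h
        by_contra hcon
        have := Nat.mul_le_mul_left (2 * wordLen D n) (not_lt.1 hcon)
        omega
      · intro h
        have h5 := Nat.mul_le_mul_left (2 * wordLen D n) (Nat.succ_le_of_lt h)
        rw [Nat.mul_succ] at h5
        omega
    rw [keeps, h1, h2, Bool.and_eq_true, Bool.or_eq_true, Nat.ble_eq, Nat.ble_eq, hlen]
    rfl
  rw [updateMem, h1, h2, h3, storeStep]
  dsimp only
  by_cases hk : keeps D H n (mem (wordLen D n) ω m L) e = true
  · rw [if_pos (h4.1 hk), hk, cond_true, mem, List.flatMap_append, List.flatMap_singleton]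
  · rw [if_neg fun h => hk (h4.2 h), Bool.eq_false_iff.2 hk, cond_false, List.append_nil, mem]

lemma storeStep_foldl_fst (D H n : ℕ) (ω : List Bool) (L : List (ℕ × ℕ)) :
    (L.foldl (storeStep D H n ω) (0, [])).1 = L.length := by
  induction L using List.reverseRecOn with
  | nil => rfl
  | append_singleton L e ih => rw [List.foldl_append, List.length_append, ← ih]; rfl

lemma storeStep_foldl_length_le (D H n : ℕ) (ω : List Bool) (L : List (ℕ × ℕ)) :
    (L.foldl (storeStep D H n ω) (0, [])).2.length ≤ storeCap D H n := by
  induction L using List.reverseRecOn with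
  | nil => exact Nat.zero_le _
  | append_singleton L e ih =>
    rw [List.foldl_append, List.foldl_cons, List.foldl_nil, storeStep]
    dsimp only
    split_ifs with h
    · rw [List.length_append, List.length_singleton]
      exact h.2
    · exact ih

/-- The edges that are stored if there is enough space. -/
def wanted (D H n : ℕ) (ω : List Bool) (L : List (ℕ × ℕ)) : List (ℕ × ℕ) :=
  L.take (exactCap D H n) ++
    (L.drop (exactCap D H n)).filter (touches (expo D H n) (buckets D H n) ω)

lemma storeStep_foldl_eq_wanted (D H n : ℕ) (ω : List Bool) (L : List (ℕ × ℕ))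
    (h : (wanted D H n ω L).length ≤ storeCap D H n) :
    (L.foldl (storeStep D H n ω) (0, [])).2 = wanted D H n ω L := by
  induction L using List.reverseRecOn with
  | nil => simp [wanted]
  | append_singleton L e ih =>
    have hw : wanted D H n ω (L ++ [e]) = wanted D H n ω L ++
        if L.length < exactCap D H n ∨ touches (expo D H n) (buckets D H n) ω e = true then [e]
          else [] := by
      unfold wanted
      rcases lt_or_ge L.length (exactCap D H n) with hl | hl
      · rw [if_pos (Or.inl hl), List.take_of_length_le (by simp; omega),
          List.take_of_length_le hl.le, List.drop_eq_nil_of_le (by simp; omega),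
          List.drop_eq_nil_of_le hl.le]
        simp
      · rw [List.take_append_of_le_length hl, List.drop_append_of_le_length hl,
          List.filter_append, List.append_assoc]
        congr 2
        by_cases ht : touches (expo D H n) (buckets D H n) ω e = true
        · rw [if_pos (Or.inr ht)]; simp [ht]
        · rw [if_neg (by rintro (h | h); exacts [absurd h (not_lt.2 hl), ht h])]
          simp [ht]
    rw [hw, List.length_append] at h
    have ih' := ih (by omega)
    rw [List.foldl_append, List.foldl_cons, List.foldl_nil, storeStep, storeStep_foldl_fst, ih',
      hw]
    dsimp only
    by_cases hc : L.length < exactCap D H n ∨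
        touches (expo D H n) (buckets D H n) ω e = true
    · rw [if_pos hc, List.length_singleton] at h
      rw [if_pos ⟨hc, by omega⟩, if_pos hc]
    · rw [if_neg (fun h => hc h.1), if_neg hc, List.append_nil]

lemma lt_two_pow_wordLen (D n : ℕ) : n < 2 ^ wordLen D n ∧ n * D < 2 ^ wordLen D n := by
  have h1 : n < 2 ^ (Nat.log 2 n + 1) := Nat.lt_pow_succ_log_self one_lt_two n
  have h2 : D < 2 ^ D := Nat.lt_two_pow_self
  rw [wordLen, pow_add]
  constructor
  · exact h1.trans_le (Nat.le_mul_of_pos_right _ (by positivity))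
  · exact Nat.mul_lt_mul'' h1 h2

/-- The memory as a function of the random bits. -/
def finalMem (D H n : ℕ) (σ : List (Fin n × Fin n)) (ω : List Bool) : List Bool :=
  mem (wordLen D n) ω (natEdges σ).length
    ((natEdges σ).foldl (storeStep D H n ω) (0, [])).2

lemma memoryAfter_algorithm (D H n : ℕ) (σ : List (Fin n × Fin n)) (hσ : σ.length ≤ n * D) :
    (algorithm D H).memoryAfter n σ =
      (StreamingAlgorithm.randomBits (seedLen D H n)).map (finalMem D H n σ) := by
  induction σ using List.reverseRecOn with
  | nil =>
    unfold StreamingAlgorithm.memoryAfter finalMem mem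
    simp [natEdges, algorithm]
  | append_singleton σ e ih =>
    rw [List.length_append, List.length_singleton] at hσ
    have ih' := ih (by omega)
    unfold StreamingAlgorithm.memoryAfter at ih' ⊢
    rw [List.foldl_append, ih', List.foldl_cons, List.foldl_nil]
    have hconst : ∀ q : List Bool, (StreamingAlgorithm.randomBits ((algorithm D H).coins n)).map
        (fun ω => (algorithm D H).update n q (e.1.val, e.2.val) ω) =
        PMF.pure (updateMem D H n q (e.1.val, e.2.val)) := fun q => PMF.map_const _ _
    simp only [hconst]
    rw [PMF.bind_map]
    unfold StreamingAlgorithm.randomBits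
    rw [PMF.bind_map, PMF.map_comp]
    rw [← PMF.bind_pure_comp]
    congr 1
    funext ω
    simp only [Function.comp_apply]
    congr 1
    have hlen : (List.ofFn ω).length = seedLen D H n := List.length_ofFn
    have hfst := storeStep_foldl_fst D H n (List.ofFn ω) (natEdges σ)
    have hlen' : (natEdges σ).length = σ.length := List.length_map _
    have h := updateMem_mem D H n (List.ofFn ω) hlen
      ((natEdges σ).foldl (storeStep D H n (List.ofFn ω)) (0, []))
      (by rw [hfst, hlen']; have := (lt_two_pow_wordLen D n).2; omega) (e.1.val, e.2.val)
    rw [hfst] at h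
    rw [finalMem, h, finalMem]
    have happ : natEdges (σ ++ [e]) = natEdges σ ++ [(e.1.val, e.2.val)] := by
      simp [natEdges]
    rw [happ, List.foldl_append, List.foldl_cons, List.foldl_nil, List.length_append,
      List.length_singleton]
    congr 1
    rw [storeStep, hfst]

lemma outputDist_algorithm (D H n : ℕ) (σ : List (Fin n × Fin n)) (hσ : σ.length ≤ n * D) :
    (algorithm D H).outputDist n σ =
      (StreamingAlgorithm.randomBits (seedLen D H n)).map fun ω =>
        ((outputOf D H n (finalMem D H n σ ω)).1 : ℝ) /
          (((outputOf D H n (finalMem D H n σ ω)).2 : ℝ) + 1) := by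
  unfold StreamingAlgorithm.outputDist
  rw [memoryAfter_algorithm D H n σ hσ]
  have hconst : ∀ q : List Bool, (StreamingAlgorithm.randomBits ((algorithm D H).coins n)).map
      (fun ω => (((algorithm D H).output n q ω).1 : ℝ) /
        ((((algorithm D H).output n q ω).2 : ℝ) + 1)) =
      PMF.pure (((outputOf D H n q).1 : ℝ) / (((outputOf D H n q).2 : ℝ) + 1)) :=
    fun q => PMF.map_const (StreamingAlgorithm.randomBits ((algorithm D H).coins n))
      (((outputOf D H n q).1 : ℝ) / (((outputOf D H n q).2 : ℝ) + 1))
  simp only [hconst]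
  rw [PMF.bind_map, ← PMF.bind_pure_comp]
  rfl

lemma length_memory_le (D H n : ℕ) (σ : List (Fin n × Fin n)) (hσ : σ.length ≤ n * D)
    (q : List Bool) (hq : q ∈ ((algorithm D H).memoryAfter n σ).support) :
    q.length ≤ seedLen D H n + wordLen D n + 2 * wordLen D n * storeCap D H n := by
  rw [memoryAfter_algorithm D H n σ hσ, PMF.support_map] at hq
  obtain ⟨ω, hω, rfl⟩ := hq
  unfold StreamingAlgorithm.randomBits at hω
  rw [PMF.support_map] at hω
  obtain ⟨f, -, rfl⟩ := hω
  rw [finalMem, length_mem, List.length_ofFn]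
  have := storeStep_foldl_length_le D H n (List.ofFn f) (natEdges σ)
  gcongr

lemma mem_wanted {D H n : ℕ} {ω : List Bool} {L : List (ℕ × ℕ)} {e : ℕ × ℕ}
    (he : e ∈ wanted D H n ω L) : e ∈ L := by
  rw [wanted, List.mem_append] at he
  exact he.elim List.mem_of_mem_take fun h => List.mem_of_mem_drop (List.mem_of_mem_filter h)

/-- The output in terms of the edges that ought to be stored, provided that there is enough
space for them. -/
lemma outputOf_finalMem (D H n : ℕ) (σ : List (Fin n × Fin n)) (hσ : σ.length ≤ n * D)
    (ω : List Bool) (hω : ω.length = seedLen D H n)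
    (hw : (wanted D H n ω (natEdges σ)).length ≤ storeCap D H n) (est : ℕ)
    (hest : est = if (natEdges σ).length ≤ exactCap D H n then
        estimate (2 * H) 0 (buckets D H n) [] (wanted D H n ω (natEdges σ))
      else estimate (2 * H) (expo D H n) (buckets D H n) ω (wanted D H n ω (natEdges σ))) :
    outputOf D H n (finalMem D H n σ ω) =
      (H * est - (2 * H) ^ 4 * (natEdges σ).length,
        H * (2 * H) ^ 4 * (natEdges σ).length - 1) := by
  have hlen' : (natEdges σ).length = σ.length := List.length_map _
  have hm : (natEdges σ).length < 2 ^ wordLen D n := by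
    have := (lt_two_pow_wordLen D n).2; omega
  have h1 : readWord (finalMem D H n σ ω) (seedLen D H n) (wordLen D n) =
      (natEdges σ).length := by
    rw [← hω]; exact readWord_mem _ _ hm _ _
  have h2 : (finalMem D H n σ ω).take (seedLen D H n) = ω := by
    rw [← hω, finalMem, mem, List.take_left]
  have h3 : readEdges (finalMem D H n σ ω) (seedLen D H n + wordLen D n) (wordLen D n) =
      wanted D H n ω (natEdges σ) := by
    rw [finalMem, storeStep_foldl_eq_wanted D H n ω _ hw, ← hω]
    refine readEdges_mem _ (wordLen_pos D n) _ _ _ fun e he => ?_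
    have h4 := natEdges_lt σ e (mem_wanted he)
    have h5 := (lt_two_pow_wordLen D n).1
    omega
  have h4 : finalEstimate D H n (finalMem D H n σ ω) = est := by
    rw [finalEstimate, h1, h2, h3, hest]
    by_cases h : (natEdges σ).length ≤ exactCap D H n
    · rw [if_pos h, Nat.ble_eq_true_of_le h, cond_true]
    · rw [if_neg h, Bool.eq_false_iff.2 (fun h' => h (Nat.le_of_ble_eq_true h')), cond_false]
  rw [outputOf, h1, h4]

/-! ### The estimator on sampled edges -/

lemma mem_positions {t R i : ℕ} {W : List ℕ} :
    i ∈ positions t R W ↔ i < R * t ∧ ∃ w ∈ W, w % R = i / t := by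
  simp [positions]

lemma sampled_iff {t R : ℕ} {ω : List Bool} {W : List ℕ} :
    sampled t R ω W = true ↔ ∀ w ∈ W, sampled t R ω [w] = true := by
  simp only [sampled, List.all_eq_true, mem_positions]
  constructor
  · rintro h w hw i ⟨hi, w', hw', he⟩
    rw [List.mem_singleton] at hw'
    exact h i ⟨hi, w, hw, hw' ▸ he⟩
  · rintro h i ⟨hi, w, hw, he⟩
    exact h w hw i ⟨hi, w, List.mem_singleton.2 rfl, he⟩

lemma estimateAt_congr {P t R : ℕ} {ω : List Bool} {L L' : List (ℕ × ℕ)}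
    (h : ∀ w, sampled t R ω [w] = true → inc L w = inc L' w) (e : ℕ × ℕ) :
    estimateAt P t R ω L e = estimateAt P t R ω L' e := by
  unfold estimateAt
  by_cases h1 : sampled t R ω (edgeBall P L e) = true
  · have h2 := sampled_iff.1 h1
    have h3 : edgeBall P L e = edgeBall P L' e :=
      edgeBall_congr (S := fun w => sampled t R ω [w] = true) h P e h2
    have h4 : edgeWeight P L e = edgeWeight P L' e :=
      edgeWeight_congr (S := fun w => sampled t R ω [w] = true) h P e h2
    rw [h3, h4]
  · have h2 : ¬ sampled t R ω (edgeBall P L' e) = true := by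
      intro h2
      have h3 : edgeBall P L' e = edgeBall P L e :=
        edgeBall_congr (S := fun w => sampled t R ω [w] = true) (fun w hw => (h w hw).symm) P e
          (sampled_iff.1 h2)
      exact h1 (h3 ▸ h2)
    rw [Bool.eq_false_iff.2 h1, Bool.eq_false_iff.2 h2, cond_false, cond_false]

lemma inc_wanted {D H n : ℕ} {ω : List Bool} (L : List (ℕ × ℕ)) {w : ℕ}
    (hw : sampled (expo D H n) (buckets D H n) ω [w] = true) :
    inc (wanted D H n ω L) w = inc L w := by
  unfold inc wanted
  rw [List.filter_append, List.filter_filter]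
  conv_rhs => rw [← List.take_append_drop (exactCap D H n) L, List.filter_append]
  congr 1
  refine List.filter_congr fun e _ => ?_
  by_cases h : e.1 = w ∨ e.2 = w
  · have : touches (expo D H n) (buckets D H n) ω e = true := by
      rw [touches, Bool.or_eq_true]
      rcases h with rfl | rfl
      · exact Or.inl hw
      · exact Or.inr hw
    rw [this, Bool.and_true]
  · simp [h]

lemma estimateAt_eq_zero {P t R : ℕ} {ω : List Bool} {L : List (ℕ × ℕ)} {e : ℕ × ℕ}
    (h : ¬ touches t R ω e = true) : estimateAt P t R ω L e = 0 := by
  rw [estimateAt]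
  have h1 : ¬ sampled t R ω (edgeBall P L e) = true := by
    intro h1
    refine h ?_
    rw [touches, Bool.or_eq_true]
    exact Or.inl (sampled_iff.1 h1 e.1 (List.mem_append_left _ (self_mem_ball L P e.1)))
  rw [Bool.eq_false_iff.2 h1, cond_false]

/-- The stored edges determine the estimator. -/
lemma estimate_wanted (P D H n : ℕ) (ω : List Bool) (L : List (ℕ × ℕ)) :
    estimate P (expo D H n) (buckets D H n) ω (wanted D H n ω L) =
      estimate P (expo D H n) (buckets D H n) ω L := by
  have h1 : estimateAt P (expo D H n) (buckets D H n) ω (wanted D H n ω L) =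
      estimateAt P (expo D H n) (buckets D H n) ω L :=
    funext fun e => estimateAt_congr (fun w hw => inc_wanted L hw) e
  rw [estimate, estimate, h1]
  generalize hf : estimateAt P (expo D H n) (buckets D H n) ω L = f
  have hz : ∀ e, ¬ touches (expo D H n) (buckets D H n) ω e = true → f e = 0 := by
    intro e he
    rw [← hf]
    exact estimateAt_eq_zero he
  have h2 : ∀ l : List (ℕ × ℕ),
      ((l.filter (touches (expo D H n) (buckets D H n) ω)).map f).sum = (l.map f).sum := by
    intro l
    induction l with
    | nil => rfl
    | cons e l ih =>
      by_cases he : touches (expo D H n) (buckets D H n) ω e = true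
      · rw [List.filter_cons_of_pos he, List.map_cons, List.sum_cons, List.map_cons,
          List.sum_cons, ih]
      · rw [List.filter_cons_of_neg he, List.map_cons, List.sum_cons, ih, hz e he, zero_add]
  rw [wanted, List.map_append, List.sum_append, h2, ← List.sum_append, ← List.map_append,
    List.take_append_drop]

lemma estimate_zero (P R : ℕ) (ω : List Bool) (L : List (ℕ × ℕ)) :
    estimate P 0 R ω L = (L.map (edgeWeight P L)).sum := by
  rw [estimate]
  congr 1
  refine List.map_congr_left fun e _ => ?_
  simp [estimateAt, sampled, positions]

/-- The positions in `positions t R W` as a finite set. -/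
def posSet (t R : ℕ) (W : List ℕ) : Finset (Fin (R * t)) :=
  Finset.univ.filter fun i => ∃ w ∈ W, w % R = i.val / t

lemma card_posSet (t R : ℕ) (W : List ℕ) :
    (posSet t R W).card = (positions t R W).length := by
  have hnd : (positions t R W).Nodup := List.nodup_range.filter _
  rw [← List.toFinset_card_of_nodup hnd]
  refine Finset.card_bij (fun i _ => i.val) ?_ ?_ ?_
  · intro i hi
    rw [List.mem_toFinset, mem_positions]
    exact ⟨i.2, (Finset.mem_filter.1 hi).2⟩
  · intro i _ j _ h
    exact Fin.ext h
  · intro i hi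
    rw [List.mem_toFinset, mem_positions] at hi
    exact ⟨⟨i, hi.1⟩, Finset.mem_filter.2 ⟨Finset.mem_univ _, hi.2⟩, rfl⟩

lemma sampled_ofFn {t R : ℕ} (ω : Fin (R * t) → Bool) (W : List ℕ) :
    sampled t R (List.ofFn ω) W = true ↔ ∀ i ∈ posSet t R W, ω i = true := by
  simp only [sampled, List.all_eq_true, mem_positions, posSet, Finset.mem_filter,
    Finset.mem_univ, true_and]
  constructor
  · intro h i hi
    have := h i ⟨i.2, hi⟩
    simpa using this
  · rintro h i ⟨hi, hw⟩
    have := h ⟨i, hi⟩ hw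
    simpa [hi] using this

lemma estimate_ofFn (P t R : ℕ) (ω : Fin (R * t) → Bool) (L : List (ℕ × ℕ)) :
    (estimate P t R (List.ofFn ω) L : ℝ) =
      ∑ j : Fin L.length, (edgeWeight P L L[j] : ℝ) *
        (allOnes (posSet t R (edgeBall P L L[j])) ω *
          2 ^ (posSet t R (edgeBall P L L[j])).card) := by
  rw [estimate, Nat.cast_list_sum, List.map_map, ← Fin.sum_univ_fun_getElem]
  refine Finset.sum_congr rfl fun j _ => ?_
  rw [Function.comp_apply, estimateAt, allOnes, card_posSet]
  by_cases h : sampled t R (List.ofFn ω) (edgeBall P L L[j]) = true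
  · have h' := (sampled_ofFn ω _).1 h
    rw [if_pos h']
    simp only [Fin.getElem_fin] at h ⊢
    rw [h, cond_true]
    push_cast
    ring
  · have h' := fun h' => h ((sampled_ofFn ω _).2 h')
    rw [if_neg h']
    simp only [Fin.getElem_fin] at h ⊢
    rw [Bool.eq_false_iff.2 h, cond_false]
    simp

lemma card_posSet_le (t R : ℕ) (W : List ℕ) : (posSet t R W).card ≤ W.length * t := by
  classical
  calc (posSet t R W).card
      ≤ (W.toFinset.biUnion fun w =>
          (Finset.univ.filter fun i : Fin (R * t) => w % R = i.val / t)).card := by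
        refine Finset.card_le_card fun i hi => ?_
        obtain ⟨w, hw, h⟩ := (Finset.mem_filter.1 hi).2
        exact Finset.mem_biUnion.2 ⟨w, List.mem_toFinset.2 hw,
          Finset.mem_filter.2 ⟨Finset.mem_univ _, h⟩⟩
    _ ≤ W.toFinset.card * t := by
        refine Finset.card_biUnion_le_card_mul _ _ _ fun w _ => ?_
        refine le_of_le_of_eq ?_ (Finset.card_range t)
        refine Finset.card_le_card_of_injOn (fun i : Fin (R * t) => i.val % t) ?_ ?_
        · intro i _
          have : 0 < t := Nat.pos_of_mul_pos_left (lt_of_le_of_lt (Nat.zero_le _) i.2)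
          simpa using Nat.mod_lt _ this
        · intro i hi j hj h
          have hi' := (Finset.mem_filter.1 (Finset.mem_coe.1 hi)).2
          have hj' := (Finset.mem_filter.1 (Finset.mem_coe.1 hj)).2
          refine Fin.ext ?_
          rw [← Nat.div_add_mod i.val t, ← Nat.div_add_mod j.val t, ← hi', ← hj']
          exact congrArg _ h
    _ ≤ W.length * t := Nat.mul_le_mul_right _ (List.toFinset_card_le W)

lemma le_card_posSet_singleton (t R v : ℕ) (hR : 0 < R) : t ≤ (posSet t R [v]).card := by
  have hlt : ∀ j < t, v % R * t + j < R * t := fun j hj => by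
    have h1 : (v % R + 1) * t ≤ R * t := Nat.mul_le_mul_right _ (Nat.mod_lt v hR)
    rw [Nat.succ_mul] at h1
    omega
  conv_lhs => rw [← Fintype.card_fin t, ← Finset.card_univ]
  refine Finset.card_le_card_of_injOn (fun j => ⟨v % R * t + j.val, hlt j.val j.2⟩) ?_ ?_
  · intro j _
    rw [Finset.mem_coe, posSet, Finset.mem_filter]
    refine ⟨Finset.mem_univ _, v, List.mem_singleton.2 rfl, ?_⟩
    have ht : 0 < t := lt_of_le_of_lt (Nat.zero_le _) j.2
    change v % R = (v % R * t + j.val) / t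
    rw [Nat.add_comm, Nat.add_mul_div_right _ _ ht, Nat.div_eq_of_lt j.2, Nat.zero_add]
  · intro i _ j _ h
    have := congrArg Fin.val h
    exact Fin.ext (by simpa using this)

lemma card_incident (L : List (ℕ × ℕ)) (u : ℕ) :
    (Finset.univ.filter fun k : Fin L.length => L[k].1 = u ∨ L[k].2 = u).card =
      (inc L u).length := by
  rw [Finset.card_filter]
  have h := Fin.sum_univ_fun_getElem L fun e => if e.1 = u ∨ e.2 = u then 1 else 0
  refine h.trans ?_
  clear h
  induction L with
  | nil => rfl
  | cons e L ih =>
    rw [List.map_cons, List.sum_cons, ih, inc, inc, List.filter_cons]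
    by_cases h : e.1 = u ∨ e.2 = u
    · simp only [h, decide_true, if_true, List.length_cons]
      ring
    · simp [h]

lemma card_mod_eq_le (n R s b : ℕ) (hn : n ≤ R * s) :
    ((Finset.range n).filter fun w => w % R = b).card ≤ s := by
  conv_rhs => rw [← Finset.card_range s]
  refine Finset.card_le_card_of_injOn (fun w => w / R) ?_ ?_
  · intro w hw
    have hw' := (Finset.mem_filter.1 (Finset.mem_coe.1 hw)).1
    rw [Finset.mem_range] at hw'
    simp only [Finset.coe_range, Set.mem_Iio]
    exact Nat.div_lt_of_lt_mul (by omega)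
  · intro w hw w' hw' h
    have h1 := (Finset.mem_filter.1 (Finset.mem_coe.1 hw)).2
    have h2 := (Finset.mem_filter.1 (Finset.mem_coe.1 hw')).2
    rw [← Nat.div_add_mod w R, ← Nat.div_add_mod w' R, h1, h2]
    exact congrArg (fun x => R * x + b) h

/-- Few pairs of edges have balls that meet a common bucket. -/
lemma card_not_disjoint_le {n D P t R s : ℕ} {L : List (ℕ × ℕ)}
    (hL : ∀ e ∈ L, e.1 < n ∧ e.2 < n) (hD : ∀ u, (inc L u).length ≤ D) (hn : n ≤ R * s)
    (j : Fin L.length) :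
    (Finset.univ.filter fun k : Fin L.length =>
      ¬ Disjoint (posSet t R (edgeBall P L L[j])) (posSet t R (edgeBall P L L[k]))).card ≤
    2 * ballBound D P * (s * (ballBound D P * D)) := by
  classical
  choose B hB hmem using exists_centers hD P
  calc _ ≤ ((edgeBall P L L[j]).toFinset.biUnion fun w =>
        ((Finset.range n).filter fun w' => w' % R = w % R).biUnion fun w' =>
          (B w').biUnion fun u =>
            Finset.univ.filter fun k : Fin L.length => L[k].1 = u ∨ L[k].2 = u).card := by
        refine Finset.card_le_card fun k hk => ?_
        have hk' := (Finset.mem_filter.1 hk).2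
        rw [Finset.not_disjoint_iff] at hk'
        obtain ⟨i, hi, hi'⟩ := hk'
        obtain ⟨w, hw, hwi⟩ := (Finset.mem_filter.1 hi).2
        obtain ⟨w', hw', hwi'⟩ := (Finset.mem_filter.1 hi').2
        have hkL := hL L[k] (List.getElem_mem _)
        rw [edgeBall, List.mem_append] at hw'
        have hlt : w' < n := hw'.elim (fun h => mem_ball_lt hL P _ hkL.1 _ h)
          (fun h => mem_ball_lt hL P _ hkL.2 _ h)
        rw [Finset.mem_biUnion]
        refine ⟨w, List.mem_toFinset.2 hw, Finset.mem_biUnion.2 ⟨w', Finset.mem_filter.2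
          ⟨Finset.mem_range.2 hlt, hwi'.trans hwi.symm⟩, ?_⟩⟩
        rw [Finset.mem_biUnion]
        rcases hw' with h | h
        · exact ⟨_, hmem w' _ h, Finset.mem_filter.2 ⟨Finset.mem_univ _, Or.inl rfl⟩⟩
        · exact ⟨_, hmem w' _ h, Finset.mem_filter.2 ⟨Finset.mem_univ _, Or.inr rfl⟩⟩
    _ ≤ (edgeBall P L L[j]).toFinset.card * (s * (ballBound D P * D)) := by
        refine Finset.card_biUnion_le_card_mul _ _ _ fun w _ => ?_
        refine (Finset.card_biUnion_le_card_mul _ _ (ballBound D P * D) fun w' _ => ?_).trans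
          (Nat.mul_le_mul_right _ (card_mod_eq_le n R s _ hn))
        refine (Finset.card_biUnion_le_card_mul _ _ D fun u _ => ?_).trans
          (Nat.mul_le_mul_right _ (hB w'))
        rw [card_incident]
        exact hD u
    _ ≤ 2 * ballBound D P * (s * (ballBound D P * D)) := by
        refine Nat.mul_le_mul_right _ ((List.toFinset_card_le _).trans ?_)
        rw [edgeBall, List.length_append, two_mul]
        exact Nat.add_le_add (length_ball_le hD P _) (length_ball_le hD P _)

/-! ### Failure probability and space -/

lemma expo_mul_le (D H n : ℕ) : (ballVol D H + 2) * expo D H n ≤ Nat.log 2 n :=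
  Nat.mul_div_le _ _

lemma expo_le_log (D H n : ℕ) : expo D H n ≤ Nat.log 2 n := Nat.div_le_self _ _

lemma buckets_pos (D H n : ℕ) : 0 < buckets D H n := by unfold buckets; positivity

lemma lt_buckets_mul (D H n : ℕ) : n < buckets D H n * 2 ^ (expo D H n + 1) := by
  have h := expo_le_log D H n
  rw [buckets, ← pow_add, ← Nat.add_assoc, Nat.sub_add_cancel h]
  exact Nat.lt_pow_succ_log_self one_lt_two n

lemma two_pow_le_buckets (D H n : ℕ) : 2 ^ ((ballVol D H + 1) * expo D H n) ≤ buckets D H n := by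
  refine Nat.pow_le_pow_right two_pos ?_
  have h := expo_mul_le D H n
  rw [show ballVol D H + 2 = ballVol D H + 1 + 1 from rfl, Nat.succ_mul] at h
  omega

lemma sum_touches_le (D H n : ℕ) (L : List (ℕ × ℕ))
    (ω : Fin (buckets D H n * expo D H n) → Bool) :
    ((L.filter (touches (expo D H n) (buckets D H n) (List.ofFn ω))).length : ℝ) ≤
      ∑ j : Fin L.length, (allOnes (posSet (expo D H n) (buckets D H n) [L[j].1]) ω +
        allOnes (posSet (expo D H n) (buckets D H n) [L[j].2]) ω) := by
  have h := Fin.sum_univ_fun_getElem L fun e =>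
    allOnes (posSet (expo D H n) (buckets D H n) [e.1]) ω +
      allOnes (posSet (expo D H n) (buckets D H n) [e.2]) ω
  refine le_of_le_of_eq ?_ h.symm
  clear h
  have hnn : ∀ A : Finset (Fin (buckets D H n * expo D H n)), 0 ≤ allOnes A ω := fun A => by
    unfold allOnes; split_ifs <;> norm_num
  induction L with
  | nil => simp
  | cons e L ih =>
    rw [List.map_cons, List.sum_cons]
    by_cases he : touches (expo D H n) (buckets D H n) (List.ofFn ω) e = true
    · rw [List.filter_cons_of_pos he, List.length_cons]
      push_cast
      have h1 : 1 ≤ allOnes (posSet (expo D H n) (buckets D H n) [e.1]) ω +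
          allOnes (posSet (expo D H n) (buckets D H n) [e.2]) ω := by
        rw [touches, Bool.or_eq_true] at he
        rcases he with he | he
        · have h2 : allOnes (posSet (expo D H n) (buckets D H n) [e.1]) ω = 1 :=
            if_pos ((sampled_ofFn ω _).1 he)
          linarith [hnn (posSet (expo D H n) (buckets D H n) [e.2])]
        · have h2 : allOnes (posSet (expo D H n) (buckets D H n) [e.2]) ω = 1 :=
            if_pos ((sampled_ofFn ω _).1 he)
          linarith [hnn (posSet (expo D H n) (buckets D H n) [e.1])]
      linarith
    · rw [List.filter_cons_of_neg he]
      linarith [hnn (posSet (expo D H n) (buckets D H n) [e.1]),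
        hnn (posSet (expo D H n) (buckets D H n) [e.2])]

/-- By Markov's inequality, the edges that ought to be stored rarely exceed the space. -/
lemma card_overflow_le {D H n : ℕ} {L : List (ℕ × ℕ)} (hm : L.length ≤ n * D) (hD : 0 < D) :
    200 * (Finset.univ.filter fun ω : Fin (seedLen D H n) → Bool =>
      storeCap D H n < (wanted D H n (List.ofFn ω) L).length).card ≤ 2 ^ seedLen D H n := by
  set t := expo D H n with ht
  set R := buckets D H n with hR
  have hRpos := buckets_pos D H n
  have hnn : ∀ (A : Finset (Fin (seedLen D H n))) ω, 0 ≤ allOnes A ω := fun A ω => by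
    unfold allOnes; split_ifs <;> norm_num
  have hmk := card_mul_le_sum (fun ω : Fin (seedLen D H n) → Bool =>
      ∑ j : Fin L.length, (allOnes (posSet t R [L[j].1]) ω + allOnes (posSet t R [L[j].2]) ω))
    (fun ω => Finset.sum_nonneg fun j _ => add_nonneg (hnn _ _) (hnn _ _))
    (800 * D * R) (fun ω => storeCap D H n < (wanted D H n (List.ofFn ω) L).length) (by
      intro ω hω
      refine le_trans ?_ (sum_touches_le D H n L ω)
      have h1 : (wanted D H n (List.ofFn ω) L).length ≤ exactCap D H n +
          (L.filter (touches t R (List.ofFn ω))).length := by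
        rw [wanted, List.length_append]
        exact Nat.add_le_add (List.length_take_le _ _)
          ((List.drop_sublist _ L).filter _).length_le
      rw [storeCap, Nat.add_mul, ← hR] at hω
      rw [exactCap, ← hR] at h1
      have h2 : 800 * D * R ≤ (L.filter (touches t R (List.ofFn ω))).length := by omega
      exact_mod_cast h2)
  set c := (Finset.univ.filter fun ω : Fin (seedLen D H n) → Bool =>
      storeCap D H n < (wanted D H n (List.ofFn ω) L).length).card
  have hone : ∀ v, (∑ ω, allOnes (posSet t R [v]) ω) * 2 ^ t ≤ (2 : ℝ) ^ seedLen D H n := by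
    intro v
    rw [← show _ = (2 : ℝ) ^ seedLen D H n from sum_allOnes (posSet t R [v])]
    refine mul_le_mul_of_nonneg_left ?_ (Finset.sum_nonneg fun ω _ => hnn _ _)
    exact pow_le_pow_right₀ one_le_two (le_card_posSet_singleton t R v hRpos)
  rw [Finset.sum_comm] at hmk
  have hsum : (∑ j : Fin L.length, ∑ ω, (allOnes (posSet t R [L[j].1]) ω +
      allOnes (posSet t R [L[j].2]) ω)) * 2 ^ t ≤ L.length * (2 * 2 ^ seedLen D H n) := by
    rw [Finset.sum_mul]
    refine (Finset.sum_le_card_nsmul _ _ (2 * 2 ^ seedLen D H n) fun j _ => ?_).trans ?_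
    · rw [Finset.sum_add_distrib, add_mul]
      linarith [hone L[j].1, hone L[j].2]
    · simp
  have hLn : (L.length : ℝ) ≤ R * 2 ^ (t + 1) * D := by
    have h1 := Nat.mul_le_mul_right D (lt_buckets_mul D H n).le
    exact_mod_cast hm.trans h1
  have hkey : (c : ℝ) * (800 * D * R) * 2 ^ t ≤
      R * 2 ^ (t + 1) * D * (2 * 2 ^ seedLen D H n) :=
    (mul_le_mul_of_nonneg_right hmk (by positivity)).trans
      (hsum.trans (mul_le_mul_of_nonneg_right hLn (by positivity)))
  have hpos : (0 : ℝ) < 4 * D * R * 2 ^ t := by positivity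
  have hfin : (200 * c : ℝ) ≤ 2 ^ seedLen D H n := by
    refine le_of_mul_le_mul_right ?_ hpos
    rw [pow_succ] at hkey
    linarith
  exact_mod_cast hfin

/-- By Chebyshev's inequality, the estimator is rarely far from its expectation, provided that the
stream is too long to be stored completely. -/
lemma card_deviation_le {D H n : ℕ} {L : List (ℕ × ℕ)} (hH : 0 < H) (hD0 : 0 < D)
    (hL : ∀ e ∈ L, e.1 < n ∧ e.2 < n) (hD : ∀ u, (inc L u).length ≤ D)
    (hm : exactCap D H n < L.length) :
    200 * (Finset.univ.filter fun ω : Fin (seedLen D H n) → Bool =>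
      ((2 * H) ^ 4 * L.length : ℝ) < H * |(estimate (2 * H) (expo D H n) (buckets D H n)
        (List.ofFn ω) L : ℝ) - (L.map (edgeWeight (2 * H) L)).sum|).card ≤
      2 ^ seedLen D H n := by
  set t := expo D H n with ht
  set R := buckets D H n with hR
  set K := ballVol D H with hK
  set b := ballBound D (2 * H) with hb
  set m := L.length with hmdef
  have hRpos : 0 < R := buckets_pos D H n
  have hH' : (0 : ℝ) < H := by exact_mod_cast hH
  have hvar := sum_sq_estimator_le (r := R * t)
    (fun j : Fin L.length => posSet t R (edgeBall (2 * H) L L[j]))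
    (fun j => (edgeWeight (2 * H) L L[j] : ℝ)) (M := (2 * H) ^ 4) (s := K * t)
    (p := K * (2 ^ (t + 1) * (b * D))) (fun j => Nat.cast_nonneg _)
    (fun j => by exact_mod_cast edgeWeight_le (2 * H) L L[j])
    (fun j => (card_posSet_le t R _).trans (Nat.mul_le_mul_right _ (by
      rw [edgeBall, List.length_append, hK, ballVol, two_mul (ballBound D (2 * H))]
      exact Nat.add_le_add (length_ball_le hD _ _) (length_ball_le hD _ _))))
    (fun j => card_not_disjoint_le hL hD (lt_buckets_mul D H n).le j)
  have hmean : ((L.map (edgeWeight (2 * H) L)).sum : ℝ) =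
      ∑ j : Fin L.length, (edgeWeight (2 * H) L L[j] : ℝ) := by
    rw [Nat.cast_list_sum, List.map_map, ← Fin.sum_univ_fun_getElem]
    rfl
  simp only [← estimate_ofFn, ← hmean] at hvar
  rw [Fintype.card_fin, ← hmdef] at hvar
  have hmpos : (0 : ℝ) < m := by
    have : 0 < m := by omega
    exact_mod_cast this
  have hmk := card_mul_le_sum (fun ω : Fin (R * t) → Bool =>
      ((estimate (2 * H) t R (List.ofFn ω) L : ℝ) - (L.map (edgeWeight (2 * H) L)).sum) ^ 2)
    (fun ω => sq_nonneg _) (((2 * H) ^ 4 * m / H) ^ 2)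
    (fun ω => ((2 * H) ^ 4 * m : ℝ) < H * |(estimate (2 * H) t R
        (List.ofFn ω) L : ℝ) - (L.map (edgeWeight (2 * H) L)).sum|) (by
      intro ω hω
      rw [← sq_abs ((estimate (2 * H) t R (List.ofFn ω) L : ℝ) - _)]
      refine pow_le_pow_left₀ (by positivity) ?_ 2
      rw [div_le_iff₀ hH']
      linarith)
  set c := (Finset.univ.filter fun ω : Fin (R * t) → Bool =>
    ((2 * H) ^ 4 * m : ℝ) < H * |(estimate (2 * H) t R
        (List.ofFn ω) L : ℝ) - (L.map (edgeWeight (2 * H) L)).sum|).card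
  have h1 := hmk.trans hvar
  -- cancel the common factor `(2 * H) ^ 8 * m`
  have h2 : (c : ℝ) * m ≤ 2 ^ (R * t) * (K * (2 ^ (t + 1) * (b * D)) * 2 ^ (K * t) * H ^ 2) := by
    have hf : (0 : ℝ) < ((2 * H : ℝ) ^ 4) ^ 2 * m / H ^ 2 := by positivity
    refine le_of_mul_le_mul_right ?_ hf
    calc (c : ℝ) * m * (((2 * H : ℝ) ^ 4) ^ 2 * m / H ^ 2)
        = c * ((2 * H) ^ 4 * m / H) ^ 2 := by ring
      _ ≤ _ := h1
      _ = _ := by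
        push_cast
        field_simp
  have h3 : (400 * K * b * D * H ^ 2 * R : ℝ) ≤ m := by
    have : capConst D H * R ≤ m := hm.le
    rw [capConst] at this
    exact_mod_cast this
  have h4 : (2 : ℝ) ^ ((K + 1) * t) ≤ R := by exact_mod_cast two_pow_le_buckets D H n
  have hbpos : 0 < b := by
    have : ∀ i, 0 < ballBound D i := fun i => by cases i <;> simp [ballBound]
    exact this _
  have hKpos : 0 < K := by rw [hK, ballVol]; omega
  have hf : (0 : ℝ) < 2 * K * b * D * H ^ 2 * R := by positivity
  have hfin : (200 * c : ℝ) ≤ 2 ^ (R * t) := by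
    refine le_of_mul_le_mul_right ?_ hf
    calc (200 * c : ℝ) * (2 * K * b * D * H ^ 2 * R)
        = (c : ℝ) * (400 * K * b * D * H ^ 2 * R) := by ring
      _ ≤ (c : ℝ) * m := mul_le_mul_of_nonneg_left h3 (Nat.cast_nonneg _)
      _ ≤ (2 : ℝ) ^ (R * t) * (K * (2 ^ (t + 1) * (b * D)) * 2 ^ (K * t) * H ^ 2) := h2
      _ = (2 : ℝ) ^ (R * t) * (2 * K * b * D * H ^ 2 * 2 ^ ((K + 1) * t)) := by
        rw [Nat.succ_mul, pow_add _ (K * t) t, pow_succ]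
        ring
      _ ≤ (2 : ℝ) ^ (R * t) * (2 * K * b * D * H ^ 2 * R) := by gcongr
  have hfin' : 200 * c ≤ 2 ^ (R * t) := by exact_mod_cast hfin
  exact hfin'

theorem approximates {D H n : ℕ} {ε : ℝ} (hH : 0 < H) (hHε : 12 ≤ ε * H)
    {G : DiMultigraph (Fin n)} (hG : G.IsBounded D) {σ : List (Fin n × Fin n)}
    (hσ : G.IsOrdering σ) (hG0 : G.edges ≠ 0) :
    (algorithm D H).ApproximatesMaxDicut G σ (1 / 2 - ε) := by
  classical
  set L := natEdges σ with hLdef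
  have hL := natEdges_lt σ
  have hD := length_inc_natEdges_le hσ hG
  have hm : L.length ≤ n * D := length_le_mul hL hD
  have hmσ : σ.length ≤ n * D := by rwa [hLdef, natEdges, List.length_map] at hm
  have hLpos : 0 < L.length := by
    rw [hLdef, length_natEdges hσ]
    exact Multiset.card_pos.2 hG0
  have hD0 : 0 < D := Nat.pos_of_ne_zero fun h => by
    rw [h, Nat.mul_zero] at hm
    omega
  unfold StreamingAlgorithm.ApproximatesMaxDicut
  rw [outputDist_algorithm D H n σ hmσ]
  rcases le_or_gt L.length (exactCap D H n) with hcap | hcap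
  · refine randomBits_map_ge _ _ (fun _ => False) (by simp) fun ω _ => ?_
    have hwL : wanted D H n (List.ofFn ω) L = L := by
      rw [wanted, List.take_of_length_le hcap, List.drop_eq_nil_of_le hcap]
      simp
    have hstore : (wanted D H n (List.ofFn ω) L).length ≤ storeCap D H n := by
      rw [hwL, storeCap, Nat.add_mul]
      exact hcap.trans (Nat.le_add_right _ _)
    have hout := outputOf_finalMem D H n σ hmσ (List.ofFn ω) List.length_ofFn hstore
      ((L.map (edgeWeight (2 * H) L)).sum) (by
        rw [if_pos hcap, ← hLdef, hwL, estimate_zero])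
    rw [hout]
    exact estimate_mem hσ hG0 hH hHε (Nat.le_add_right _ _) (Nat.le_add_right _ _)
  · refine randomBits_map_ge _ _ (fun ω =>
      storeCap D H n < (wanted D H n (List.ofFn ω) L).length ∨
      ((2 * H) ^ 4 * L.length : ℝ) < H * |(estimate (2 * H) (expo D H n) (buckets D H n)
        (List.ofFn ω) L : ℝ) - (L.map (edgeWeight (2 * H) L)).sum|) ?_ fun ω hω => ?_
    · rw [Finset.filter_or]
      have h1 := card_overflow_le (D := D) (H := H) hm hD0
      have h2 := card_deviation_le (L := L) hH hD0 hL hD hcap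
      refine (Nat.mul_le_mul_left 100 (Finset.card_union_le _ _)).trans ?_
      omega
    · push Not at hω
      obtain ⟨hstore, hdev⟩ := hω
      have hout := outputOf_finalMem D H n σ hmσ (List.ofFn ω) List.length_ofFn hstore
        (estimate (2 * H) (expo D H n) (buckets D H n) (List.ofFn ω) L) (by
          rw [if_neg (not_le.2 hcap), estimate_wanted])
      rw [hout]
      have hH' : (0 : ℝ) < H := by exact_mod_cast hH
      have h1 := mul_le_mul_of_nonneg_left (le_abs_self
        ((estimate (2 * H) (expo D H n) (buckets D H n) (List.ofFn ω) L : ℝ) -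
          (L.map (edgeWeight (2 * H) L)).sum)) hH'.le
      have h2 := mul_le_mul_of_nonneg_left (neg_abs_le
        ((estimate (2 * H) (expo D H n) (buckets D H n) (List.ofFn ω) L : ℝ) -
          (L.map (edgeWeight (2 * H) L)).sum)) hH'.le
      refine estimate_mem hσ hG0 hH hHε ?_ ?_
      · have h3 : (H : ℝ) * estimate (2 * H) (expo D H n) (buckets D H n) (List.ofFn ω) L ≤
            H * (L.map (edgeWeight (2 * H) L)).sum + (2 * H) ^ 4 * L.length := by linarith
        exact_mod_cast h3
      · have h3 : (H : ℝ) * (L.map (edgeWeight (2 * H) L)).sum ≤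
            H * estimate (2 * H) (expo D H n) (buckets D H n) (List.ofFn ω) L
              + (2 * H) ^ 4 * L.length := by linarith
        exact_mod_cast h3

lemma log_add_one_le {n : ℕ} (hn : 1 ≤ n) {a : ℝ} (ha : 0 < a) :
    ((Nat.log 2 n : ℝ) + 1) ≤ (1 + 1 / (a * Real.log 2)) * (n : ℝ) ^ a := by
  have hn' : (1 : ℝ) ≤ n := by exact_mod_cast hn
  have hl2 : 0 < Real.log 2 := Real.log_pos one_lt_two
  have h1 : (Nat.log 2 n : ℝ) * Real.log 2 ≤ Real.log n := by
    rw [← Real.log_pow]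
    refine Real.log_le_log (by positivity) ?_
    exact_mod_cast Nat.pow_log_le_self 2 (by omega)
  have h2 : Real.log n ≤ (n : ℝ) ^ a / a := Real.log_le_rpow_div (by linarith) ha
  have h3 : (1 : ℝ) ≤ (n : ℝ) ^ a := Real.one_le_rpow hn' ha.le
  have h4 : (Nat.log 2 n : ℝ) ≤ 1 / (a * Real.log 2) * (n : ℝ) ^ a := by
    rw [← le_div_iff₀ hl2] at h1
    refine h1.trans ?_
    rw [div_le_iff₀ hl2]
    refine h2.trans (le_of_eq ?_)
    field_simp
  linarith

lemma buckets_le {D H n : ℕ} (hn : 1 ≤ n) :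
    (buckets D H n : ℝ) ≤ 2 * (n : ℝ) ^ (1 - 1 / ((ballVol D H : ℝ) + 2)) := by
  set M : ℝ := (ballVol D H : ℝ) + 2 with hM
  have hMpos : 0 < M := by positivity
  have hM1 : 1 / M ≤ 1 := by
    rw [div_le_one hMpos]
    have : (0 : ℝ) ≤ ballVol D H := Nat.cast_nonneg _
    linarith
  set N := Nat.log 2 n with hN
  have h1 : ((N - expo D H n : ℕ) : ℝ) ≤ 1 + N * (1 - 1 / M) := by
    rw [Nat.cast_sub (expo_le_log D H n)]
    have h2 : (N : ℝ) / M ≤ expo D H n + 1 := by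
      rw [div_le_iff₀ hMpos]
      have h3 : N ≤ (expo D H n + 1) * (ballVol D H + 2) := by
        rw [Nat.succ_mul]
        exact (Nat.lt_div_mul_add (by omega)).le
      have h4 : (N : ℝ) ≤ (expo D H n + 1) * (ballVol D H + 2) := by exact_mod_cast h3
      exact h4
    have h5 : (N : ℝ) * (1 - 1 / M) = N - N / M := by ring
    linarith
  have h6 : (2 : ℝ) ^ N ≤ n := by exact_mod_cast Nat.pow_log_le_self 2 (by omega)
  calc (buckets D H n : ℝ) = (2 : ℝ) ^ ((N - expo D H n : ℕ) : ℝ) := by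
        rw [Real.rpow_natCast, buckets]
        push_cast
        rfl
    _ ≤ (2 : ℝ) ^ (1 + N * (1 - 1 / M)) := Real.rpow_le_rpow_of_exponent_le one_le_two h1
    _ = 2 * ((2 : ℝ) ^ N) ^ (1 - 1 / M) := by
        rw [Real.rpow_add two_pos, Real.rpow_one, Real.rpow_mul two_pos.le, Real.rpow_natCast]
    _ ≤ 2 * (n : ℝ) ^ (1 - 1 / M) := by
        gcongr

/-- The memory is sublinear: the number of buckets is `n ^ (1 - 2 * c)` up to a constant factor,
and `log n` is absorbed by `n ^ c`. -/
lemma exists_space_bound (D H : ℕ) : ∃ c C : ℝ, 0 < c ∧ c < 1 ∧ ∀ n : ℕ, 1 ≤ n →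
    ((seedLen D H n + wordLen D n + 2 * wordLen D n * storeCap D H n : ℕ) : ℝ) ≤
      C * (n : ℝ) ^ (1 - c) := by
  set M : ℝ := (ballVol D H : ℝ) + 2 with hM
  have hM2 : 2 ≤ M := by
    have : (0 : ℝ) ≤ ballVol D H := Nat.cast_nonneg _
    linarith
  set a : ℝ := 1 / (2 * M) with ha
  have hapos : 0 < a := by positivity
  have ha1 : a < 1 := by
    rw [ha, div_lt_one (by positivity)]
    linarith
  set B : ℕ := 1 + (D + 1) + 2 * (D + 1) * (capConst D H + 800 * D) with hB
  refine ⟨a, B * (2 * (1 + 1 / (a * Real.log 2))), hapos, ha1, fun n hn => ?_⟩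
  have hn' : (0 : ℝ) < n := by exact_mod_cast hn
  have h1 : seedLen D H n + wordLen D n + 2 * wordLen D n * storeCap D H n ≤
      B * (buckets D H n * (Nat.log 2 n + 1)) := by
    have hR := buckets_pos D H n
    set R := buckets D H n
    set N := Nat.log 2 n with hN
    have e1 : seedLen D H n ≤ R * (N + 1) :=
      Nat.mul_le_mul_left _ ((expo_le_log D H n).trans (Nat.le_succ _))
    have e2 : wordLen D n ≤ (D + 1) * (N + 1) := by
      rw [wordLen, ← hN]
      nlinarith [Nat.zero_le (D * N)]
    have e3 : (D + 1) * (N + 1) ≤ (D + 1) * (R * (N + 1)) :=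
      Nat.mul_le_mul_left _ (Nat.le_mul_of_pos_left _ hR)
    calc seedLen D H n + wordLen D n + 2 * wordLen D n * storeCap D H n
        ≤ R * (N + 1) + (D + 1) * (R * (N + 1)) +
            2 * ((D + 1) * (N + 1)) * ((capConst D H + 800 * D) * R) := by
          refine Nat.add_le_add (Nat.add_le_add e1 (e2.trans e3)) ?_
          exact Nat.mul_le_mul (Nat.mul_le_mul_left _ e2) le_rfl
      _ = B * (R * (N + 1)) := by rw [hB]; ring
  have h2 : ((buckets D H n * (Nat.log 2 n + 1) : ℕ) : ℝ) ≤
      2 * (1 + 1 / (a * Real.log 2)) * (n : ℝ) ^ (1 - a) := by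
    push_cast
    have e1 : 1 - a = (1 - 1 / M) + a := by
      rw [ha]
      field_simp
      ring
    have hl2 : 0 < Real.log 2 := Real.log_pos one_lt_two
    calc (buckets D H n : ℝ) * ((Nat.log 2 n : ℝ) + 1)
        ≤ (2 * (n : ℝ) ^ (1 - 1 / M)) * ((1 + 1 / (a * Real.log 2)) * (n : ℝ) ^ a) :=
          mul_le_mul (buckets_le hn) (log_add_one_le hn hapos) (by positivity) (by positivity)
      _ = 2 * (1 + 1 / (a * Real.log 2)) * (n : ℝ) ^ (1 - a) := by
          rw [e1, Real.rpow_add hn']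
          ring
  calc ((seedLen D H n + wordLen D n + 2 * wordLen D n * storeCap D H n : ℕ) : ℝ)
      ≤ ((B * (buckets D H n * (Nat.log 2 n + 1)) : ℕ) : ℝ) := by exact_mod_cast h1
    _ = B * ((buckets D H n * (Nat.log 2 n + 1) : ℕ) : ℝ) := by push_cast; ring
    _ ≤ B * (2 * (1 + 1 / (a * Real.log 2)) * (n : ℝ) ^ (1 - a)) :=
        mul_le_mul_of_nonneg_left h2 (Nat.cast_nonneg _)
    _ = _ := by ring

end LocalDicut

theorem theorem1 (D : ℕ) (ε : ℝ) (hε : 0 < ε) :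
    ∃ (A : StreamingAlgorithm) (c C : ℝ), 0 < c ∧ c < 1 ∧
      ∀ n : ℕ, 1 ≤ n → ∀ G : DiMultigraph (Fin n), G.IsBounded D →
        ∀ σ : List (Fin n × Fin n), G.IsOrdering σ →
          A.UsesSpaceAtMost n σ (C * (n : ℝ) ^ (1 - c)) ∧
          (G.edges ≠ 0 → A.ApproximatesMaxDicut G σ (1 / 2 - ε)) := by
  obtain ⟨H, hH⟩ := exists_nat_gt (12 / ε)
  have hH0 : 0 < H := by
    have : (0 : ℝ) < H := lt_trans (by positivity) hH
    exact_mod_cast this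
  have hHε : 12 ≤ ε * H := by
    rw [div_lt_iff₀ hε] at hH
    linarith
  obtain ⟨c, C, hc0, hc1, hspace⟩ := LocalDicut.exists_space_bound D H
  refine ⟨LocalDicut.algorithm D H, c, C, hc0, hc1, fun n hn G hG σ hσ => ⟨?_, ?_⟩⟩
  · intro τ hτ q hq
    refine le_trans ?_ (hspace n hn)
    have hm := LocalDicut.length_le_mul (LocalDicut.natEdges_lt σ)
      (LocalDicut.length_inc_natEdges_le hσ hG)
    rw [LocalDicut.natEdges, List.length_map] at hm
    exact_mod_cast LocalDicut.length_memory_le D H n τ (hτ.length_le.trans hm) q hq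
  · exact fun hG0 => LocalDicut.approximates hH0 hHε hG hσ hG0
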